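/- **The theory CaTT.** Expressions are built over a countably infinite set of variables, by mutual recursion. A type is $\star$ or $t\to_A u$, with $A$ a type and $t,u$ terms. A term is a variable, or $\mathsf{op}_{\Gamma,A}[\gamma]$, or $\mathsf{coh}_{\Gamma,A}[\gamma]$, with $\Gamma$ a context, $A$ a type and $\gamma$ a substitution. A context is a list $(x_1:A_1,\dots,x_n:A_n)$ and a substitution is a list $\langle x_1\mapsto t_1,\dots,x_n\mapsto t_n\rangle$. Substitutions act on types and terms by replacing variables, with $\mathsf{op}_{\Gamma,A}[\delta][\gamma]=\mathsf{op}_{\Gamma,A}[\delta\circ\gamma]$, where $\delta\circ\gamma$ is obtained by applying $\gamma$ to every term of $\delta$, and similarly for $\mathsf{coh}$. $\mathrm{Var}(-)$ denotes the set of variables occurring in the arguments $\gamma$ and at the leaves of an expression (for a context: the declared variables). *Ps-contexts.* The judgment $\Gamma\vdash_{\mathsf{ps}}x:A$ is generated by: $(x:\star)\vdash_{\mathsf{ps}}x:\star$; if $\Gamma\vdash_{\mathsf{ps}}f:x\to_A y$ then $\Gamma\vdash_{\mathsf{ps}}y:A$; if $\Gamma\vdash_{\mathsf{ps}}x:A$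 and $y,f$ are distinct and not in $\mathrm{Var}(\Gamma)$, then $(\Gamma,y:A,f:x\to_A y)\vdash_{\mathsf{ps}}f:x\to_A y$. $\Gamma$ is a ps-context if $\Gamma\vdash_{\mathsf{ps}}x:\star$ for some $x$. A variable of type $\star$ has dimension $0$, one of type $t\to_A u$ has dimension one more than a variable of type $A$, and $\dim\Gamma$ is the largest dimension of a variable of $\Gamma$. Put $\partial_i^\pm(x:\star)=(x:\star)$ and, for $\Gamma'=(\Gamma,y:A,f:x\to_A y)$ with $y$ of dimension $k$: $\partial_i^-\Gamma'$ is $\partial_i^-\Gamma$ if $k\ge i$, and $(\partial_i^-\Gamma,y:A,f:x\to_A y)$ otherwise; $\partial_i^+\Gamma'$ is $\partial_i^+\Gamma$ if $k>i$, is $\partial_i^+\Gamma$ with its last variable replaced by $y:A$ if $k=i$, and is $(\partial_i^+\Gamma,y:A,f:x\to_A y)$ otherwise. If $\dim\Gamma\ge1$, write $\partial^\pm\Gamma=\partial^\pm_{\dim\Gamma-1}\Gamma$. *Rules.* The empty context is valid; $(\Gamma,x:A)$ is valid if $\Gamma\vdash A$ and $x\notin\mathrm{Var}(\Gamma)$.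 $\Gamma\vdash\star$ if $\Gamma$ is valid; $\Gamma\vdash t\to_A u$ if $\Gamma\vdash t:A$ and $\Gamma\vdash u:A$. $\Gamma\vdash x:A$ if $\Gamma$ is valid and contains $x:A$. $\Delta\vdash\langle\rangle:\varnothing$ if $\Delta$ is valid; $\Delta\vdash\langle\gamma,x\mapsto t\rangle:(\Gamma,x:A)$ if $\Delta\vdash\gamma:\Gamma$, $\Gamma\vdash A$, $x\notin\mathrm{Var}(\Gamma)$ and $\Delta\vdash t:A[\gamma]$. If $\Gamma\vdash_{\mathsf{op}}A$ (resp. $\Gamma\vdash_{\mathsf{eq}}A$) and $\Delta\vdash\gamma:\Gamma$, then $\Delta\vdash\mathsf{op}_{\Gamma,A}[\gamma]:A[\gamma]$ (resp. $\Delta\vdash\mathsf{coh}_{\Gamma,A}[\gamma]:A[\gamma]$). Here, for a ps-context $\Gamma$: $\Gamma\vdash_{\mathsf{op}}t\to_A u$ if $\dim\Gamma\ge1$, $\partial^-\Gamma\vdash t:A$, $\partial^+\Gamma\vdash u:A$, $\mathrm{Var}(t)\cup\mathrm{Var}(A)=\mathrm{Var}(\partial^-\Gamma)$ and $\mathrm{Var}(u)\cup\mathrm{Var}(A)=\mathrm{Var}(\partial^+\Gamma)$;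 and $\Gamma\vdash_{\mathsf{eq}}t\to_A u$ if $\Gamma\vdash t:A$, $\Gamma\vdash u:A$ and $\mathrm{Var}(t)\cup\mathrm{Var}(A)=\mathrm{Var}(u)\cup\mathrm{Var}(A)=\mathrm{Var}(\Gamma)$. The category $\mathrm{Syn}(\mathrm{CaTT})$ has the valid contexts as objects and the valid substitutions $\Delta\vdash\gamma:\Gamma$ as morphisms $\Delta\to\Gamma$. **The theory MCaTT.** Its types are $\mathbf 1$ and $t\to_A u$; its terms are variables, a constant $()$, and $\mathsf{mop}_{\Theta,A}[\gamma]$, $\mathsf{mcoh}_{\Theta,A}[\gamma]$ with $\Theta$ a context and $A$ a type **of CaTT** and $\gamma$ a substitution of MCaTT; contexts, substitutions and the action of substitutions are as before. The *desuspension* $\chi$ sends expressions of CaTT to expressions of MCaTT by $\chi\star=\mathbf 1$, $\chi(t\to_A u)=\chi t\to_{\chi A}\chi u$, $\chi x=x$, $\chi(\mathsf{op}_{\Theta,A}[\gamma])=\mathsf{mop}_{\Theta,A}[\chi\gamma]$, $\chi(\mathsf{coh}_{\Theta,A}[\gamma])=\mathsf{mcoh}_{\Theta,A}[\chi\gamma]$,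 and entrywise on contexts and substitutions. The rules of MCaTT for contexts, substitutions, variables and arrow types are those of CaTT (with $\Gamma\vdash A$ also required for $\Gamma\vdash t\to_A u$). Moreover, if $\Gamma$ is valid then $\Gamma\vdash\mathbf 1$ and $\Gamma\vdash():\mathbf 1$; and if $\Theta\vdash_{\mathsf{op}}A$ (resp. $\Theta\vdash_{\mathsf{eq}}A$) in CaTT and $\Delta\vdash\gamma:\chi\Theta$, then $\Delta\vdash\mathsf{mop}_{\Theta,A}[\gamma]:(\chi A)[\gamma]$ (resp. $\Delta\vdash\mathsf{mcoh}_{\Theta,A}[\gamma]:(\chi A)[\gamma]$). Definitional equality $\equiv$ of contexts, types, terms and substitutions is the congruence generated by the $\eta$-rule: $\Gamma\vdash t\equiv u:\mathbf 1$ whenever $\Gamma\vdash t:\mathbf 1$ and $\Gamma\vdash u:\mathbf 1$. A term of type $A$ also has every type that is definitionally equal to $A$. The category $\mathrm{Syn}(\mathrm{MCaTT})$ has as objects the valid contexts of MCaTT up to definitional equality, and as morphisms $\Delta\to\Gamma$ the valid substitutions $\Delta\vdash\gamma:\Gamma$ up to definitional equality. **The two functors.** The desuspension $\chi$ induces a functor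 $\chi:\mathrm{Syn}(\mathrm{CaTT})\to\mathrm{Syn}(\mathrm{MCaTT})$. The *reduced suspension* $\Sigma:\mathrm{Syn}(\mathrm{MCaTT})\to\mathrm{Syn}(\mathrm{CaTT})$ is given, using a variable $\bullet$ that is fresh for the expressions of MCaTT (the variables of the target being those of the source together with $\bullet$), as follows. - $\Sigma\varnothing=(\bullet:\star)$; $\Sigma(\Gamma,x:\mathbf 1)=\Sigma\Gamma$; $\Sigma(\Gamma,x:A)=(\Sigma\Gamma,x:\Sigma A)$ if $A\ne\mathbf 1$. - $\Sigma\mathbf 1=\star$ and $\Sigma(t\to_A u)=\Sigma t\to_{\Sigma A}\Sigma u$. - $\Sigma()=\bullet$; $\Sigma x=\bullet$ if $x$ has type $\mathbf 1$ and $\Sigma x=x$ otherwise; $\Sigma(\mathsf{mop}_{\Theta,A}[\gamma])=\mathsf{op}_{\Theta,A}[\bullet_\Theta\circ\Sigma\gamma]$ and $\Sigma(\mathsf{mcoh}_{\Theta,A}[\gamma])=\mathsf{coh}_{\Theta,A}[\bullet_\Theta\circ\Sigma\gamma]$. Here $\Sigma\chi\Theta\vdash\bullet_\Theta:\Theta$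 sends a variable of type $\star$ to $\bullet$ and every other variable to itself. - $\Sigma\langle\rangle=\langle\bullet\mapsto\bullet\rangle$; for $\langle\gamma,x\mapsto t\rangle:(\Gamma,x:A)$, $\Sigma\langle\gamma,x\mapsto t\rangle=\Sigma\gamma$ if $A=\mathbf 1$, and $\langle\Sigma\gamma,x\mapsto\Sigma t\rangle$ otherwise. **Proposition.** There is a natural isomorphism $$\eta:\mathrm{id}_{\mathrm{Syn}(\mathrm{MCaTT})}\Longrightarrow\chi\circ\Sigma$$ whose component at every valid context $\Gamma$ of MCaTT is the (valid) substitution $\Gamma\vdash\eta_\Gamma:\chi\Sigma\Gamma$ given by $\bullet\mapsto()$ and $x\mapsto x$ for every variable $x$ of $\Gamma$ whose type is not $\mathbf 1$. Moreover, for every type $\Gamma\vdash A$ of MCaTT, $$\Gamma\vdash A\equiv(\chi\Sigma A)[\eta_\Gamma],$$ and for every term $\Gamma\vdash t:A$ of MCaTT, $$\Gamma\vdash t\equiv(\chi\Sigma t)[\eta_\Gamma]:A.$$ -/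

import Mathlib

open CategoryTheory

namespace CaTT

/-- The two families of term constructors: operations and coherences. -/
inductive Kind
  | op
  | coh

mutual
/-- Raw types of `CaTT`. -/
inductive Ty : Type
  | obj : Ty
  | hom (A : Ty) (t u : Tm) : Ty
/-- Raw terms of `CaTT`: variables, and `op_{Γ,A}[γ]`, `coh_{Γ,A}[γ]`. Variables are natural
numbers. -/
inductive Tm : Type
  | var (x : ℕ) : Tm
  | con (k : Kind) (Γ : Ctx) (A : Ty) (γ : Sub) : Tm
/-- Raw substitutions of `CaTT`: lists of mappings `x ↦ t`. -/
inductive Sub : Type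
  | nil : Sub
  | cons (γ : Sub) (x : ℕ) (t : Tm) : Sub
/-- Raw contexts of `CaTT`: association lists `x : A`. -/
inductive Ctx : Type
  | nil : Ctx
  | cons (Γ : Ctx) (x : ℕ) (A : Ty) : Ctx
end

mutual
/-- The variables of a type. -/
def Ty.vars : Ty → Finset ℕ
  | .obj => ∅
  | .hom A t u => A.vars ∪ t.vars ∪ u.vars
/-- The variables of a term. -/
def Tm.vars : Tm → Finset ℕ
  | .var x => {x}
  | .con _ _ _ γ => γ.vars
/-- The variables of a substitution. -/
def Sub.vars : Sub → Finset ℕ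
  | .nil => ∅
  | .cons γ _ t => γ.vars ∪ t.vars
end

/-- The variables of a context. -/
def Ctx.vars : Ctx → Finset ℕ
  | .nil => ∅
  | .cons Γ x _ => insert x Γ.vars

/-- `Γ.Mem x A` means `(x : A) ∈ Γ`. -/
def Ctx.Mem : Ctx → ℕ → Ty → Prop
  | .nil, _, _ => False
  | .cons Γ y B, x, A => (x = y ∧ A = B) ∨ Γ.Mem x A

/-- The action of a substitution on a variable. -/
def Sub.get : Sub → ℕ → Tm
  | .nil, x => .var x
  | .cons γ y t, x => if x = y then t else γ.get x

mutual
/-- The action `A[γ]` of a substitution on a type. -/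
def Ty.subst : Ty → Sub → Ty
  | .obj, _ => .obj
  | .hom A t u, γ => .hom (A.subst γ) (t.subst γ) (u.subst γ)
/-- The action `t[γ]` of a substitution on a term. -/
def Tm.subst : Tm → Sub → Tm
  | .var x, γ => γ.get x
  | .con k Γ A δ, γ => .con k Γ A (δ.comp γ)
/-- The composition `δ ∘ γ` of substitutions, written `δ.comp γ`. -/
def Sub.comp : Sub → Sub → Sub
  | .nil, _ => .nil
  | .cons δ x t, γ => .cons (δ.comp γ) x (t.subst γ)
end

/-- The identity substitution of a context. -/
def Ctx.idSub : Ctx → Sub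
  | .nil => .nil
  | .cons Γ x _ => .cons Γ.idSub x (.var x)

/-- `Γ ⊢ps x : A`: the partial ps-contexts with dangling variable `x : A`. -/
inductive PsPartial : Ctx → ℕ → Ty → Prop
  | pss (x : ℕ) : PsPartial (.cons .nil x .obj) x .obj
  | psd {Γ : Ctx} {f x y : ℕ} {A : Ty} :
      PsPartial Γ f (.hom A (.var x) (.var y)) → PsPartial Γ y A
  | pse {Γ : Ctx} {x y f : ℕ} {A : Ty} :
      PsPartial Γ x A → y ∉ Γ.vars → f ∉ insert y Γ.vars →
      PsPartial (.cons (.cons Γ y A) f (.hom A (.var x) (.var y))) f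
        (.hom A (.var x) (.var y))

/-- `Γ ⊢ps`: the ps-contexts. -/
def Ps (Γ : Ctx) : Prop := ∃ x, PsPartial Γ x .obj

/-- The dimension of the cells of a given type (objects have dimension `0`); it is one more than
the dimension of the type itself in the convention where the type `obj` has dimension `-1`. -/
def Ty.cellDim : Ty → ℕ
  | .obj => 0
  | .hom A _ _ => A.cellDim + 1

/-- The dimension of a context: the largest dimension of its variables. -/
def Ctx.dim : Ctx → ℕ
  | .nil => 0
  | .cons Γ _ A => max Γ.dim A.cellDim

/-- Removal of the last variable. -/
def Ctx.drop : Ctx → Ctx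
  | .nil => .nil
  | .cons Γ _ _ => Γ

/-- The `i`-source of a ps-context. -/
def Ctx.src (i : ℕ) : Ctx → Ctx
  | .cons (.cons Γ y A) f B =>
      if i ≤ A.cellDim then Γ.src i else .cons (.cons (Γ.src i) y A) f B
  | Γ => Γ

/-- The `i`-target of a ps-context. -/
def Ctx.tgt (i : ℕ) : Ctx → Ctx
  | .cons (.cons Γ y A) f B =>
      if i < A.cellDim then Γ.tgt i
      else if A.cellDim = i then .cons (Γ.tgt i).drop y A
      else .cons (.cons (Γ.tgt i) y A) f B
  | Γ => Γ

/-- The judgments of `CaTT`. The judgment `adm k Γ A` is `Γ ⊢op A` when `k = op`, and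
`Γ ⊢eq A` when `k = coh`. -/
inductive Judgment
  | ctx (Γ : Ctx)
  | ty (Γ : Ctx) (A : Ty)
  | tm (Γ : Ctx) (t : Tm) (A : Ty)
  | sub (Δ : Ctx) (γ : Sub) (Γ : Ctx)
  | adm (k : Kind) (Γ : Ctx) (A : Ty)

/-- Derivability in `CaTT`. The source and target of a ps-context `Γ` are taken in dimension
`dim Γ - 1`, and are not defined when `dim Γ = 0`. -/
inductive Der : Judgment → Prop
  | ec : Der (.ctx .nil)
  | ce {Γ : Ctx} {x : ℕ} {A : Ty} :
      Der (.ty Γ A) → x ∉ Γ.vars → Der (.ctx (.cons Γ x A))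
  | obj_intro {Γ : Ctx} : Der (.ctx Γ) → Der (.ty Γ .obj)
  | hom_intro {Γ : Ctx} {A : Ty} {t u : Tm} :
      Der (.tm Γ t A) → Der (.tm Γ u A) → Der (.ty Γ (.hom A t u))
  | var {Γ : Ctx} {x : ℕ} {A : Ty} :
      Der (.ctx Γ) → Γ.Mem x A → Der (.tm Γ (.var x) A)
  | con_intro {k : Kind} {Γ Δ : Ctx} {A : Ty} {γ : Sub} :
      Der (.adm k Γ A) → Der (.sub Δ γ Γ) → Der (.tm Δ (.con k Γ A γ) (A.subst γ))
  | es {Δ : Ctx} : Der (.ctx Δ) → Der (.sub Δ .nil .nil)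
  | se {Δ Γ : Ctx} {γ : Sub} {x : ℕ} {A : Ty} {t : Tm} :
      Der (.sub Δ γ Γ) → Der (.ty Γ A) → x ∉ Γ.vars → Der (.tm Δ t (A.subst γ)) →
      Der (.sub Δ (.cons γ x t) (.cons Γ x A))
  | adm_op {Γ : Ctx} {A : Ty} {t u : Tm} {i : ℕ} :
      Ps Γ → Γ.dim = i + 1 →
      Der (.tm (Γ.src i) t A) → Der (.tm (Γ.tgt i) u A) →
      t.vars ∪ A.vars = (Γ.src i).vars → u.vars ∪ A.vars = (Γ.tgt i).vars →
      Der (.adm .op Γ (.hom A t u))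
  | adm_coh {Γ : Ctx} {A : Ty} {t u : Tm} :
      Ps Γ → Der (.tm Γ t A) → Der (.tm Γ u A) →
      t.vars ∪ A.vars = Γ.vars → u.vars ∪ A.vars = Γ.vars →
      Der (.adm .coh Γ (.hom A t u))

/-! ### Elementary properties -/

/-- The variables assigned by a substitution. -/
def Sub.dom : Sub → Finset ℕ
  | .nil => ∅
  | .cons γ x _ => insert x γ.dom

theorem Ctx.Mem.mem_vars {Γ : Ctx} {x : ℕ} {A : Ty} (h : Γ.Mem x A) : x ∈ Γ.vars := by
  induction Γ using Ctx.vars.induct with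
  | case1 => exact h.elim
  | case2 Γ y B ih =>
    rcases h with ⟨rfl, _⟩ | h
    · simp [Ctx.vars]
    · simp [Ctx.vars, ih h]

theorem Ctx.get_idSub (Γ : Ctx) (x : ℕ) : Γ.idSub.get x = .var x := by
  induction Γ using Ctx.vars.induct with
  | case1 => rfl
  | case2 Γ y B ih =>
    simp only [Ctx.idSub, Sub.get, ih]
    split_ifs with h <;> simp [h]

mutual
theorem Ty.subst_idSub (Γ : Ctx) : (A : Ty) → A.subst Γ.idSub = A
  | .obj => rfl
  | .hom A t u => by
    simp only [Ty.subst, Ty.subst_idSub Γ A, Tm.subst_idSub Γ t, Tm.subst_idSub Γ u]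
theorem Tm.subst_idSub (Γ : Ctx) : (t : Tm) → t.subst Γ.idSub = t
  | .var x => by simp only [Tm.subst, Ctx.get_idSub]
  | .con k Θ A γ => by simp only [Tm.subst, Sub.comp_idSub Γ γ]
theorem Sub.comp_idSub (Γ : Ctx) : (γ : Sub) → γ.comp Γ.idSub = γ
  | .nil => rfl
  | .cons γ x t => by simp only [Sub.comp, Sub.comp_idSub Γ γ, Tm.subst_idSub Γ t]
end

mutual
theorem Ty.subst_cons {γ : Sub} {x : ℕ} {s : Tm} :
    (A : Ty) → x ∉ A.vars → A.subst (.cons γ x s) = A.subst γ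
  | .obj, _ => rfl
  | .hom A t u, h => by
    simp only [Ty.vars, Finset.mem_union, not_or] at h
    simp only [Ty.subst, Ty.subst_cons A h.1.1, Tm.subst_cons t h.1.2, Tm.subst_cons u h.2]
theorem Tm.subst_cons {γ : Sub} {x : ℕ} {s : Tm} :
    (t : Tm) → x ∉ t.vars → t.subst (.cons γ x s) = t.subst γ
  | .var y, h => by
    simp only [Tm.vars, Finset.mem_singleton] at h
    simp only [Tm.subst, Sub.get, if_neg (Ne.symm h)]
  | .con k Θ A δ, h => by
    simp only [Tm.vars] at h
    simp only [Tm.subst, Sub.comp_cons δ h]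
theorem Sub.comp_cons {γ : Sub} {x : ℕ} {s : Tm} :
    (δ : Sub) → x ∉ δ.vars → δ.comp (.cons γ x s) = δ.comp γ
  | .nil, _ => rfl
  | .cons δ y t, h => by
    simp only [Sub.vars, Finset.mem_union, not_or] at h
    simp only [Sub.comp, Sub.comp_cons δ h.1, Tm.subst_cons t h.2]
end

theorem Sub.get_comp {γ δ : Sub} {x : ℕ} (h : x ∈ γ.dom) :
    (γ.comp δ).get x = (γ.get x).subst δ := by
  induction γ using Sub.dom.induct with
  | case1 => simp [Sub.dom] at h
  | case2 γ y t ih =>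
    simp only [Sub.comp, Sub.get]
    split_ifs with hxy
    · rfl
    · exact ih (by simpa [Sub.dom, hxy] using h)

mutual
theorem Ty.subst_subst {γ δ : Sub} :
    (A : Ty) → A.vars ⊆ γ.dom → (A.subst γ).subst δ = A.subst (γ.comp δ)
  | .obj, _ => rfl
  | .hom A t u, h => by
    simp only [Ty.vars, Finset.union_subset_iff] at h
    simp only [Ty.subst, Ty.subst_subst A h.1.1, Tm.subst_subst t h.1.2, Tm.subst_subst u h.2]
theorem Tm.subst_subst {γ δ : Sub} :
    (t : Tm) → t.vars ⊆ γ.dom → (t.subst γ).subst δ = t.subst (γ.comp δ)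
  | .var x, h => by
    simp only [Tm.vars, Finset.singleton_subset_iff] at h
    simp only [Tm.subst, Sub.get_comp h]
  | .con k Θ A θ, h => by
    simp only [Tm.vars] at h
    simp only [Tm.subst, Sub.comp_comp θ h]
theorem Sub.comp_comp {γ δ : Sub} :
    (θ : Sub) → θ.vars ⊆ γ.dom → (θ.comp γ).comp δ = θ.comp (γ.comp δ)
  | .nil, _ => rfl
  | .cons θ x t, h => by
    simp only [Sub.vars, Finset.union_subset_iff] at h
    simp only [Sub.comp, Sub.comp_comp θ h.1, Tm.subst_subst t h.2]
end

theorem Ctx.drop_mem {Γ : Ctx} {x : ℕ} {A : Ty} (h : Γ.drop.Mem x A) : Γ.Mem x A := by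
  cases Γ with
  | nil => exact h
  | cons Γ y B => exact Or.inr h

theorem Ctx.src_mem {i : ℕ} {Γ : Ctx} {x : ℕ} {A : Ty} (h : (Γ.src i).Mem x A) :
    Γ.Mem x A := by
  induction Γ using Ctx.src.induct i with
  | case1 Γ y B f C hi ih =>
    rw [Ctx.src, if_pos hi] at h
    exact Or.inr (Or.inr (ih h))
  | case2 Γ y B f C hi ih =>
    rw [Ctx.src, if_neg hi] at h
    exact h.imp_right (Or.imp_right ih)
  | case3 Γ hΓ => rwa [Ctx.src] at h; exact hΓ

theorem Ctx.tgt_mem {i : ℕ} {Γ : Ctx} {x : ℕ} {A : Ty} (h : (Γ.tgt i).Mem x A) :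
    Γ.Mem x A := by
  induction Γ using Ctx.tgt.induct i with
  | case1 Γ y B f C hi ih =>
    rw [Ctx.tgt, if_pos hi] at h
    exact Or.inr (Or.inr (ih h))
  | case2 Γ y B f C hi hi' ih =>
    rw [Ctx.tgt, if_neg hi, if_pos hi'] at h
    rcases h with h | h
    · exact Or.inr (Or.inl h)
    · exact Or.inr (Or.inr (ih (Ctx.drop_mem h)))
  | case3 Γ y B f C hi hi' ih =>
    rw [Ctx.tgt, if_neg hi, if_neg hi'] at h
    exact h.imp_right (Or.imp_right ih)
  | case4 Γ hΓ => rwa [Ctx.tgt] at h; exact hΓ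

theorem Ctx.exists_mem {Γ : Ctx} {x : ℕ} (h : x ∈ Γ.vars) : ∃ A, Γ.Mem x A := by
  induction Γ using Ctx.vars.induct with
  | case1 => simp [Ctx.vars] at h
  | case2 Γ y B ih =>
    rcases Finset.mem_insert.1 h with rfl | h
    · exact ⟨B, Or.inl ⟨rfl, rfl⟩⟩
    · obtain ⟨A, hA⟩ := ih h
      exact ⟨A, Or.inr hA⟩

theorem Sub.get_vars {γ : Sub} {x : ℕ} (h : x ∈ γ.dom) : (γ.get x).vars ⊆ γ.vars := by
  induction γ using Sub.dom.induct with
  | case1 => simp [Sub.dom] at h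
  | case2 γ y t ih =>
    simp only [Sub.get, Sub.vars]
    split_ifs with hxy
    · exact Finset.subset_union_right
    · exact (ih (by simpa [Sub.dom, hxy] using h)).trans Finset.subset_union_left

mutual
theorem Ty.vars_subst {γ : Sub} : (A : Ty) → A.vars ⊆ γ.dom → (A.subst γ).vars ⊆ γ.vars
  | .obj, _ => by simp [Ty.subst, Ty.vars]
  | .hom A t u, h => by
    simp only [Ty.vars, Finset.union_subset_iff] at h
    simp only [Ty.subst, Ty.vars, Finset.union_subset_iff]
    exact ⟨⟨Ty.vars_subst A h.1.1, Tm.vars_subst t h.1.2⟩, Tm.vars_subst u h.2⟩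
theorem Tm.vars_subst {γ : Sub} : (t : Tm) → t.vars ⊆ γ.dom → (t.subst γ).vars ⊆ γ.vars
  | .var x, h => Sub.get_vars (by simpa [Tm.vars] using h)
  | .con k Θ A θ, h => by
    simp only [Tm.vars] at h
    simpa only [Tm.subst, Tm.vars] using Sub.vars_comp θ h
theorem Sub.vars_comp {γ : Sub} : (θ : Sub) → θ.vars ⊆ γ.dom → (θ.comp γ).vars ⊆ γ.vars
  | .nil, _ => by simp [Sub.comp, Sub.vars]
  | .cons θ x t, h => by
    simp only [Sub.vars, Finset.union_subset_iff] at h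
    simp only [Sub.comp, Sub.vars, Finset.union_subset_iff]
    exact ⟨Sub.vars_comp θ h.1, Tm.vars_subst t h.2⟩
end

/-- The types of a context only use its variables. -/
def Ctx.Scoped (Γ : Ctx) : Prop := ∀ x A, Γ.Mem x A → A.vars ⊆ Γ.vars

/-- What a derivable judgment says about variables. -/
def Judgment.Scoped : Judgment → Prop
  | .ctx Γ => Γ.Scoped
  | .ty Γ A => Γ.Scoped ∧ A.vars ⊆ Γ.vars
  | .tm Γ t A => Γ.Scoped ∧ t.vars ⊆ Γ.vars ∧ A.vars ⊆ Γ.vars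
  | .sub Δ γ Γ => Δ.Scoped ∧ γ.vars ⊆ Δ.vars ∧ γ.dom = Γ.vars
  | .adm _ Γ A => A.vars ⊆ Γ.vars

theorem Ctx.vars_subset {Γ Δ : Ctx} (h : ∀ x A, Γ.Mem x A → Δ.Mem x A) :
    Γ.vars ⊆ Δ.vars := fun _ hx =>
  let ⟨A, hA⟩ := Ctx.exists_mem hx
  (h _ A hA).mem_vars

theorem Der.scoped {J : Judgment} (h : Der J) : J.Scoped := by
  induction h with
  | ec => exact fun _ _ h => h.elim
  | @ce Γ x A hA hx ih =>
    intro y B h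
    refine Finset.Subset.trans ?_ (Finset.subset_insert x Γ.vars)
    rcases h with ⟨_, rfl⟩ | h
    · exact ih.2
    · exact ih.1 _ _ h
  | obj_intro _ ih => exact ⟨ih, by simp [Ty.vars]⟩
  | hom_intro _ _ ih₁ ih₂ =>
    exact ⟨ih₁.1, Finset.union_subset (Finset.union_subset ih₁.2.2 ih₁.2.1) ih₂.2.1⟩
  | var _ hx ih =>
    exact ⟨ih, by simpa [Tm.vars] using hx.mem_vars, ih _ _ hx⟩
  | con_intro _ _ ihA ih =>
    exact ⟨ih.1, ih.2.1, (Ty.vars_subst _ (by rw [ih.2.2]; exact ihA)).trans ih.2.1⟩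
  | es _ ih => exact ⟨ih, by simp [Sub.vars], rfl⟩
  | se _ _ _ _ ih₁ _ ih₃ =>
    exact ⟨ih₁.1, Finset.union_subset ih₁.2.1 ih₃.2.1, by simp [Sub.dom, Ctx.vars, ih₁.2.2]⟩
  | @adm_op Γ A t u i _ _ _ _ h₁ h₂ _ _ =>
    have e₁ := Ctx.vars_subset (fun x A => Ctx.src_mem (i := i) (Γ := Γ) (x := x) (A := A))
    have e₂ := Ctx.vars_subset (fun x A => Ctx.tgt_mem (i := i) (Γ := Γ) (x := x) (A := A))
    rw [← h₁] at e₁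
    rw [← h₂] at e₂
    have e₁ := Finset.union_subset_iff.1 e₁
    exact Finset.union_subset (Finset.union_subset e₁.2 e₁.1) (Finset.union_subset_iff.1 e₂).1
  | adm_coh _ _ _ _ _ ih₁ ih₂ =>
    exact Finset.union_subset (Finset.union_subset ih₁.2.2 ih₁.2.1) ih₂.2.1

/-- The validity of contexts presupposed by a judgment. -/
def Judgment.Presup : Judgment → Prop
  | .ctx Γ => Der (.ctx Γ)
  | .ty Γ _ => Der (.ctx Γ)
  | .tm Γ _ _ => Der (.ctx Γ)
  | .sub Δ _ Γ => Der (.ctx Δ) ∧ Der (.ctx Γ)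
  | .adm _ _ _ => True

theorem Der.presup {J : Judgment} (h : Der J) : J.Presup := by
  induction h with
  | ec => exact .ec
  | ce hA hx _ => exact .ce hA hx
  | obj_intro _ ih => exact ih
  | hom_intro _ _ ih _ => exact ih
  | var h _ _ => exact h
  | con_intro _ _ _ ih => exact ih.1
  | es h _ => exact ⟨h, .ec⟩
  | se _ hA hx _ ih _ _ => exact ⟨ih.1, .ce hA hx⟩
  | adm_op => trivial
  | adm_coh => trivial

/-- The validity of the judgment in larger contexts. -/
def Judgment.Weaken : Judgment → Prop
  | .ty Γ A => ∀ Γ', (∀ x A, Γ.Mem x A → Γ'.Mem x A) → Der (.ctx Γ') → Der (.ty Γ' A)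
  | .tm Γ t A => ∀ Γ', (∀ x A, Γ.Mem x A → Γ'.Mem x A) → Der (.ctx Γ') → Der (.tm Γ' t A)
  | .sub Δ γ Γ => ∀ Δ', (∀ x A, Δ.Mem x A → Δ'.Mem x A) → Der (.ctx Δ') → Der (.sub Δ' γ Γ)
  | _ => True

theorem Der.weaken {J : Judgment} (h : Der J) : J.Weaken := by
  induction h with
  | ec => trivial
  | ce => trivial
  | obj_intro _ _ => exact fun _ _ h => .obj_intro h
  | hom_intro _ _ ih₁ ih₂ => exact fun _ h h' => .hom_intro (ih₁ _ h h') (ih₂ _ h h')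
  | var _ hx _ => exact fun _ h h' => .var h' (h _ _ hx)
  | con_intro hA _ _ ih => exact fun _ h h' => .con_intro hA (ih _ h h')
  | es _ _ => exact fun _ _ h => .es h
  | se _ hA hx _ ih₁ _ ih₃ => exact fun _ h h' => .se (ih₁ _ h h') hA hx (ih₃ _ h h')
  | adm_op => trivial
  | adm_coh => trivial

theorem Der.sub_get {Δ Γ : Ctx} {γ : Sub} (hΓ : Der (.ctx Γ)) {x : ℕ} {A : Ty}
    (h : Der (.sub Δ γ Γ)) (hx : Γ.Mem x A) : Der (.tm Δ (γ.get x) (A.subst γ)) := by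
  induction Γ using Ctx.vars.induct generalizing γ with
  | case1 => exact hx.elim
  | case2 Γ y B ih =>
    cases hΓ with | ce hB hy =>
    cases h with | @se _ _ γ _ _ t hγ _ _ ht =>
    rcases hx with ⟨rfl, rfl⟩ | hx
    · rw [Ty.subst_cons _ (fun h => hy (hB.scoped.2 h))]
      simpa [Sub.get] using ht
    · have hne : x ≠ y := by rintro rfl; exact hy hx.mem_vars
      rw [Ty.subst_cons _ (fun h => hy (hB.scoped.1 _ _ hx h))]
      simpa [Sub.get, hne] using ih hB.presup hγ hx

/-- The stability of the judgment under substitution. -/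
def Judgment.Subst : Judgment → Prop
  | .ty Γ A => ∀ Δ γ, Der (.sub Δ γ Γ) → Der (.ty Δ (A.subst γ))
  | .tm Γ t A => ∀ Δ γ, Der (.sub Δ γ Γ) → Der (.tm Δ (t.subst γ) (A.subst γ))
  | .sub Γ δ Θ => ∀ Δ γ, Der (.sub Δ γ Γ) → Der (.sub Δ (δ.comp γ) Θ)
  | _ => True

theorem Der.subst {J : Judgment} (h : Der J) : J.Subst := by
  induction h with
  | ec => trivial
  | ce => trivial
  | obj_intro _ _ => exact fun _ _ h => .obj_intro h.presup.1
  | hom_intro _ _ ih₁ ih₂ => exact fun _ _ h => .hom_intro (ih₁ _ _ h) (ih₂ _ _ h)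
  | var hΓ hx _ => exact fun _ _ h => Der.sub_get hΓ h hx
  | con_intro hA hγ _ ih =>
    intro _ _ h
    rw [Ty.subst_subst _ (by rw [hγ.scoped.2.2]; exact hA.scoped)]
    exact .con_intro hA (ih _ _ h)
  | es _ _ => exact fun _ _ h => .es h.presup.1
  | se hγ hA hx _ ih₁ _ ih₃ =>
    intro _ _ h
    refine .se (ih₁ _ _ h) hA hx ?_
    rw [← Ty.subst_subst _ (by rw [hγ.scoped.2.2]; exact hA.scoped.2)]
    exact ih₃ _ _ h
  | adm_op => trivial
  | adm_coh => trivial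

theorem Der.idSub {Γ : Ctx} (h : Der (.ctx Γ)) : Der (.sub Γ Γ.idSub Γ) := by
  induction Γ using Ctx.vars.induct with
  | case1 => exact .es h
  | case2 Γ x A ih =>
    have hΓ := h
    cases h with | ce hA hx =>
    refine .se ((ih hA.presup).weaken _ (fun _ _ => Or.inr) hΓ) hA hx ?_
    rw [Ty.subst_idSub]
    exact .var hΓ (Or.inl ⟨rfl, rfl⟩)

theorem Ctx.vars_idSub (Γ : Ctx) : Γ.idSub.vars = Γ.vars := by
  induction Γ using Ctx.vars.induct with
  | case1 => rfl
  | case2 Γ x A ih => simp [Ctx.idSub, Sub.vars, Ctx.vars, Tm.vars, ih]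

theorem Der.idSub_comp {Δ Γ : Ctx} {γ : Sub} (h : Der (.sub Δ γ Γ)) : Γ.idSub.comp γ = γ := by
  induction Γ using Ctx.vars.induct generalizing γ with
  | case1 => cases h; rfl
  | case2 Γ x A ih =>
    cases h with | @se _ _ γ _ _ t hγ _ hx ht =>
    simp [Ctx.idSub, Sub.comp, Tm.subst, Sub.get,
      Sub.comp_cons Γ.idSub (x := x) (by rwa [Ctx.vars_idSub]), ih hγ]

end CaTT

/-- The syntactic category of `CaTT`: its objects are the valid contexts. -/
structure SynCaTT : Type where
  ctx : CaTT.Ctx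
  der : CaTT.Der (.ctx ctx)

namespace SynCaTT

/-- A morphism `Δ ⟶ Γ` is a valid substitution `Δ ⊢ γ : Γ`. -/
@[ext]
structure Hom (Δ Γ : SynCaTT) : Type where
  sub : CaTT.Sub
  der : CaTT.Der (.sub Δ.ctx sub Γ.ctx)

instance : Category SynCaTT where
  Hom := Hom
  id Γ := ⟨Γ.ctx.idSub, Γ.der.idSub⟩
  comp f g := ⟨g.sub.comp f.sub, g.der.subst _ _ f.der⟩
  id_comp f := Hom.ext (CaTT.Sub.comp_idSub _ _)
  comp_id f := Hom.ext f.der.idSub_comp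
  assoc f g h := Hom.ext
    (CaTT.Sub.comp_comp _ (by rw [g.der.scoped.2.2]; exact h.der.scoped.2.1)).symm

end SynCaTT

namespace MCaTT

mutual
/-- Raw types of `MCaTT`. -/
inductive Ty : Type
  | unit : Ty
  | hom (A : Ty) (t u : Tm) : Ty
/-- Raw terms of `MCaTT`: variables, the constant `()`, and `mop_{Θ,A}[γ]`, `mcoh_{Θ,A}[γ]` where
`Θ` and `A` are expressions of `CaTT`. -/
inductive Tm : Type
  | var (x : ℕ) : Tm
  | tt : Tm
  | con (k : CaTT.Kind) (Θ : CaTT.Ctx) (A : CaTT.Ty) (γ : Sub) : Tm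
/-- Raw substitutions of `MCaTT`. -/
inductive Sub : Type
  | nil : Sub
  | cons (γ : Sub) (x : ℕ) (t : Tm) : Sub
end

/-- Raw contexts of `MCaTT`. -/
inductive Ctx : Type
  | nil : Ctx
  | cons (Γ : Ctx) (x : ℕ) (A : Ty) : Ctx

/-- The variables of a context. -/
def Ctx.vars : Ctx → Finset ℕ
  | .nil => ∅
  | .cons Γ x _ => insert x Γ.vars

/-- `Γ.Mem x A` means `(x : A) ∈ Γ`. -/
def Ctx.Mem : Ctx → ℕ → Ty → Prop
  | .nil, _, _ => False
  | .cons Γ y B, x, A => (x = y ∧ A = B) ∨ Γ.Mem x A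

/-- The action of a substitution on a variable. -/
def Sub.get : Sub → ℕ → Tm
  | .nil, x => .var x
  | .cons γ y t, x => if x = y then t else γ.get x

mutual
/-- The action `A[γ]` of a substitution on a type. -/
def Ty.subst : Ty → Sub → Ty
  | .unit, _ => .unit
  | .hom A t u, γ => .hom (A.subst γ) (t.subst γ) (u.subst γ)
/-- The action `t[γ]` of a substitution on a term. -/
def Tm.subst : Tm → Sub → Tm
  | .var x, γ => γ.get x
  | .tt, _ => .tt
  | .con k Θ A δ, γ => .con k Θ A (δ.comp γ)
/-- The composition `δ ∘ γ` of substitutions, written `δ.comp γ`. -/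
def Sub.comp : Sub → Sub → Sub
  | .nil, _ => .nil
  | .cons δ x t, γ => .cons (δ.comp γ) x (t.subst γ)
end

/-- The identity substitution of a context. -/
def Ctx.idSub : Ctx → Sub
  | .nil => .nil
  | .cons Γ x _ => .cons Γ.idSub x (.var x)

end MCaTT

/-! ### The desuspension on raw expressions -/

mutual
/-- The desuspension of a type. -/
def CaTT.Ty.desusp : CaTT.Ty → MCaTT.Ty
  | .obj => .unit
  | .hom A t u => .hom A.desusp t.desusp u.desusp
/-- The desuspension of a term. -/
def CaTT.Tm.desusp : CaTT.Tm → MCaTT.Tm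
  | .var x => .var x
  | .con k Γ A γ => .con k Γ A γ.desusp
/-- The desuspension of a substitution. -/
def CaTT.Sub.desusp : CaTT.Sub → MCaTT.Sub
  | .nil => .nil
  | .cons γ x t => .cons γ.desusp x t.desusp
end

/-- The desuspension of a context. -/
def CaTT.Ctx.desusp : CaTT.Ctx → MCaTT.Ctx
  | .nil => .nil
  | .cons Γ x A => .cons Γ.desusp x A.desusp

namespace MCaTT

/-- The judgments of `MCaTT`, including definitional equality. -/
inductive Judgment
  | ctx (Γ : Ctx)
  | ty (Γ : Ctx) (A : Ty)
  | tm (Γ : Ctx) (t : Tm) (A : Ty)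
  | sub (Δ : Ctx) (γ : Sub) (Γ : Ctx)
  | ctxEq (Γ Γ' : Ctx)
  | tyEq (Γ : Ctx) (A B : Ty)
  | tmEq (Γ : Ctx) (t u : Tm) (A : Ty)
  | subEq (Δ : Ctx) (γ γ' : Sub) (Γ : Ctx)

/-- Derivability in `MCaTT`. Definitional equality is the congruence generated by `eta`. -/
inductive Der : Judgment → Prop
  | ec : Der (.ctx .nil)
  | ce {Γ : Ctx} {x : ℕ} {A : Ty} :
      Der (.ty Γ A) → x ∉ Γ.vars → Der (.ctx (.cons Γ x A))
  | unit_intro {Γ : Ctx} : Der (.ctx Γ) → Der (.ty Γ .unit)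
  | hom_intro {Γ : Ctx} {A : Ty} {t u : Tm} :
      Der (.ty Γ A) → Der (.tm Γ t A) → Der (.tm Γ u A) → Der (.ty Γ (.hom A t u))
  | var {Γ : Ctx} {x : ℕ} {A : Ty} :
      Der (.ctx Γ) → Γ.Mem x A → Der (.tm Γ (.var x) A)
  | tt_intro {Γ : Ctx} : Der (.ctx Γ) → Der (.tm Γ .tt .unit)
  | con_intro {k : CaTT.Kind} {Θ : CaTT.Ctx} {A : CaTT.Ty} {Δ : Ctx} {γ : Sub} :
      CaTT.Der (.adm k Θ A) → Der (.sub Δ γ Θ.desusp) →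
      Der (.tm Δ (.con k Θ A γ) (A.desusp.subst γ))
  | conv {Γ : Ctx} {t : Tm} {A B : Ty} :
      Der (.tm Γ t A) → Der (.tyEq Γ A B) → Der (.tm Γ t B)
  | es {Δ : Ctx} : Der (.ctx Δ) → Der (.sub Δ .nil .nil)
  | se {Δ Γ : Ctx} {γ : Sub} {x : ℕ} {A : Ty} {t : Tm} :
      Der (.sub Δ γ Γ) → Der (.ty Γ A) → x ∉ Γ.vars → Der (.tm Δ t (A.subst γ)) →
      Der (.sub Δ (.cons γ x t) (.cons Γ x A))
  | eta {Γ : Ctx} {t u : Tm} :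
      Der (.tm Γ t .unit) → Der (.tm Γ u .unit) → Der (.tmEq Γ t u .unit)
  | ty_refl {Γ : Ctx} {A : Ty} : Der (.ty Γ A) → Der (.tyEq Γ A A)
  | ty_symm {Γ : Ctx} {A B : Ty} : Der (.tyEq Γ A B) → Der (.tyEq Γ B A)
  | ty_trans {Γ : Ctx} {A B C : Ty} :
      Der (.tyEq Γ A B) → Der (.tyEq Γ B C) → Der (.tyEq Γ A C)
  | hom_congr {Γ : Ctx} {A A' : Ty} {t t' u u' : Tm} :
      Der (.tyEq Γ A A') → Der (.tmEq Γ t t' A) → Der (.tmEq Γ u u' A) →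
      Der (.tyEq Γ (.hom A t u) (.hom A' t' u'))
  | tm_refl {Γ : Ctx} {t : Tm} {A : Ty} : Der (.tm Γ t A) → Der (.tmEq Γ t t A)
  | tm_symm {Γ : Ctx} {t u : Tm} {A : Ty} : Der (.tmEq Γ t u A) → Der (.tmEq Γ u t A)
  | tm_trans {Γ : Ctx} {t u v : Tm} {A : Ty} :
      Der (.tmEq Γ t u A) → Der (.tmEq Γ u v A) → Der (.tmEq Γ t v A)
  | tm_conv {Γ : Ctx} {t u : Tm} {A B : Ty} :
      Der (.tmEq Γ t u A) → Der (.tyEq Γ A B) → Der (.tmEq Γ t u B)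
  | con_congr {k : CaTT.Kind} {Θ : CaTT.Ctx} {A : CaTT.Ty} {Δ : Ctx} {γ γ' : Sub} :
      CaTT.Der (.adm k Θ A) → Der (.subEq Δ γ γ' Θ.desusp) →
      Der (.tmEq Δ (.con k Θ A γ) (.con k Θ A γ') (A.desusp.subst γ))
  | sub_refl {Δ Γ : Ctx} {γ : Sub} : Der (.sub Δ γ Γ) → Der (.subEq Δ γ γ Γ)
  | sub_symm {Δ Γ : Ctx} {γ γ' : Sub} : Der (.subEq Δ γ γ' Γ) → Der (.subEq Δ γ' γ Γ)
  | sub_trans {Δ Γ : Ctx} {γ γ' γ'' : Sub} :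
      Der (.subEq Δ γ γ' Γ) → Der (.subEq Δ γ' γ'' Γ) → Der (.subEq Δ γ γ'' Γ)
  | se_congr {Δ Γ : Ctx} {γ γ' : Sub} {x : ℕ} {A : Ty} {t t' : Tm} :
      Der (.subEq Δ γ γ' Γ) → Der (.ty Γ A) → x ∉ Γ.vars → Der (.tmEq Δ t t' (A.subst γ)) →
      Der (.subEq Δ (.cons γ x t) (.cons γ' x t') (.cons Γ x A))
  | ec_congr : Der (.ctxEq .nil .nil)
  | ce_congr {Γ Γ' : Ctx} {x : ℕ} {A A' : Ty} :
      Der (.ctxEq Γ Γ') → Der (.tyEq Γ A A') → x ∉ Γ.vars →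
      Der (.ctxEq (.cons Γ x A) (.cons Γ' x A'))

/-! ### Elementary properties -/

mutual
/-- The variables occurring in a raw type. -/
def Ty.vars : Ty → Finset ℕ
  | .unit => ∅
  | .hom A t u => A.vars ∪ t.vars ∪ u.vars
/-- The variables occurring in a raw term. -/
def Tm.vars : Tm → Finset ℕ
  | .var x => {x}
  | .tt => ∅
  | .con _ _ _ γ => γ.vars
/-- The variables occurring in a raw substitution. -/
def Sub.vars : Sub → Finset ℕ
  | .nil => ∅
  | .cons γ _ t => γ.vars ∪ t.vars
end

/-- The variables assigned by a substitution. -/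
def Sub.dom : Sub → Finset ℕ
  | .nil => ∅
  | .cons γ x _ => insert x γ.dom

mutual
theorem vars_desusp_ty : (A : CaTT.Ty) → A.desusp.vars = A.vars
  | .obj => rfl
  | .hom A t u => by
    simp only [CaTT.Ty.desusp, Ty.vars, CaTT.Ty.vars, vars_desusp_ty A, vars_desusp_tm t,
      vars_desusp_tm u]
theorem vars_desusp_tm : (t : CaTT.Tm) → t.desusp.vars = t.vars
  | .var x => rfl
  | .con k Θ A γ => by simp only [CaTT.Tm.desusp, Tm.vars, CaTT.Tm.vars, vars_desusp_sub γ]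
theorem vars_desusp_sub : (γ : CaTT.Sub) → γ.desusp.vars = γ.vars
  | .nil => rfl
  | .cons γ x t => by
    simp only [CaTT.Sub.desusp, Sub.vars, CaTT.Sub.vars, vars_desusp_sub γ, vars_desusp_tm t]
end

theorem vars_desusp (Γ : CaTT.Ctx) : Γ.desusp.vars = Γ.vars := by
  induction Γ using CaTT.Ctx.vars.induct with
  | case1 => rfl
  | case2 Γ x A ih => simp only [CaTT.Ctx.desusp, Ctx.vars, CaTT.Ctx.vars, ih]

theorem Ctx.Mem.mem_vars {Γ : Ctx} {x : ℕ} {A : Ty} (h : Γ.Mem x A) : x ∈ Γ.vars := by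
  induction Γ using Ctx.vars.induct with
  | case1 => exact h.elim
  | case2 Γ y B ih =>
    rcases h with ⟨rfl, _⟩ | h
    · simp [Ctx.vars]
    · simp [Ctx.vars, ih h]

theorem Ctx.get_idSub (Γ : Ctx) (x : ℕ) : Γ.idSub.get x = .var x := by
  induction Γ using Ctx.vars.induct with
  | case1 => rfl
  | case2 Γ y B ih =>
    simp only [Ctx.idSub, Sub.get, ih]
    split_ifs with h <;> simp [h]

mutual
theorem Ty.subst_idSub (Γ : Ctx) : (A : Ty) → A.subst Γ.idSub = A
  | .unit => rfl
  | .hom A t u => by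
    simp only [Ty.subst, Ty.subst_idSub Γ A, Tm.subst_idSub Γ t, Tm.subst_idSub Γ u]
theorem Tm.subst_idSub (Γ : Ctx) : (t : Tm) → t.subst Γ.idSub = t
  | .var x => by simp only [Tm.subst, Ctx.get_idSub]
  | .tt => rfl
  | .con k Θ A γ => by simp only [Tm.subst, Sub.comp_idSub Γ γ]
theorem Sub.comp_idSub (Γ : Ctx) : (γ : Sub) → γ.comp Γ.idSub = γ
  | .nil => rfl
  | .cons γ x t => by simp only [Sub.comp, Sub.comp_idSub Γ γ, Tm.subst_idSub Γ t]
end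

mutual
theorem Ty.subst_cons {γ : Sub} {x : ℕ} {s : Tm} :
    (A : Ty) → x ∉ A.vars → A.subst (.cons γ x s) = A.subst γ
  | .unit, _ => rfl
  | .hom A t u, h => by
    simp only [Ty.vars, Finset.mem_union, not_or] at h
    simp only [Ty.subst, Ty.subst_cons A h.1.1, Tm.subst_cons t h.1.2, Tm.subst_cons u h.2]
theorem Tm.subst_cons {γ : Sub} {x : ℕ} {s : Tm} :
    (t : Tm) → x ∉ t.vars → t.subst (.cons γ x s) = t.subst γ
  | .var y, h => by
    simp only [Tm.vars, Finset.mem_singleton] at h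
    simp only [Tm.subst, Sub.get, if_neg (Ne.symm h)]
  | .tt, _ => rfl
  | .con k Θ A δ, h => by
    simp only [Tm.vars] at h
    simp only [Tm.subst, Sub.comp_cons δ h]
theorem Sub.comp_cons {γ : Sub} {x : ℕ} {s : Tm} :
    (δ : Sub) → x ∉ δ.vars → δ.comp (.cons γ x s) = δ.comp γ
  | .nil, _ => rfl
  | .cons δ y t, h => by
    simp only [Sub.vars, Finset.mem_union, not_or] at h
    simp only [Sub.comp, Sub.comp_cons δ h.1, Tm.subst_cons t h.2]
end

theorem Sub.get_comp {γ δ : Sub} {x : ℕ} (h : x ∈ γ.dom) :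
    (γ.comp δ).get x = (γ.get x).subst δ := by
  induction γ using Sub.dom.induct with
  | case1 => simp [Sub.dom] at h
  | case2 γ y t ih =>
    simp only [Sub.comp, Sub.get]
    split_ifs with hxy
    · rfl
    · exact ih (by simpa [Sub.dom, hxy] using h)

mutual
theorem Ty.subst_subst {γ δ : Sub} :
    (A : Ty) → A.vars ⊆ γ.dom → (A.subst γ).subst δ = A.subst (γ.comp δ)
  | .unit, _ => rfl
  | .hom A t u, h => by
    simp only [Ty.vars, Finset.union_subset_iff] at h
    simp only [Ty.subst, Ty.subst_subst A h.1.1, Tm.subst_subst t h.1.2, Tm.subst_subst u h.2]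
theorem Tm.subst_subst {γ δ : Sub} :
    (t : Tm) → t.vars ⊆ γ.dom → (t.subst γ).subst δ = t.subst (γ.comp δ)
  | .var x, h => by
    simp only [Tm.vars, Finset.singleton_subset_iff] at h
    simp only [Tm.subst, Sub.get_comp h]
  | .tt, _ => rfl
  | .con k Θ A θ, h => by
    simp only [Tm.vars] at h
    simp only [Tm.subst, Sub.comp_comp θ h]
theorem Sub.comp_comp {γ δ : Sub} :
    (θ : Sub) → θ.vars ⊆ γ.dom → (θ.comp γ).comp δ = θ.comp (γ.comp δ)
  | .nil, _ => rfl
  | .cons θ x t, h => by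
    simp only [Sub.vars, Finset.union_subset_iff] at h
    simp only [Sub.comp, Sub.comp_comp θ h.1, Tm.subst_subst t h.2]
end

theorem Sub.get_vars {γ : Sub} {x : ℕ} (h : x ∈ γ.dom) : (γ.get x).vars ⊆ γ.vars := by
  induction γ using Sub.dom.induct with
  | case1 => simp [Sub.dom] at h
  | case2 γ y t ih =>
    simp only [Sub.get, Sub.vars]
    split_ifs with hxy
    · exact Finset.subset_union_right
    · exact (ih (by simpa [Sub.dom, hxy] using h)).trans Finset.subset_union_left

mutual
theorem Ty.vars_subst {γ : Sub} : (A : Ty) → A.vars ⊆ γ.dom → (A.subst γ).vars ⊆ γ.vars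
  | .unit, _ => by simp [Ty.subst, Ty.vars]
  | .hom A t u, h => by
    simp only [Ty.vars, Finset.union_subset_iff] at h
    simp only [Ty.subst, Ty.vars, Finset.union_subset_iff]
    exact ⟨⟨Ty.vars_subst A h.1.1, Tm.vars_subst t h.1.2⟩, Tm.vars_subst u h.2⟩
theorem Tm.vars_subst {γ : Sub} : (t : Tm) → t.vars ⊆ γ.dom → (t.subst γ).vars ⊆ γ.vars
  | .var x, h => Sub.get_vars (by simpa [Tm.vars] using h)
  | .tt, _ => by simp [Tm.subst, Tm.vars]
  | .con k Θ A θ, h => by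
    simp only [Tm.vars] at h
    simpa only [Tm.subst, Tm.vars] using Sub.vars_comp θ h
theorem Sub.vars_comp {γ : Sub} : (θ : Sub) → θ.vars ⊆ γ.dom → (θ.comp γ).vars ⊆ γ.vars
  | .nil, _ => by simp [Sub.comp, Sub.vars]
  | .cons θ x t, h => by
    simp only [Sub.vars, Finset.union_subset_iff] at h
    simp only [Sub.comp, Sub.vars, Finset.union_subset_iff]
    exact ⟨Sub.vars_comp θ h.1, Tm.vars_subst t h.2⟩
end

/-- The types of a context only use its variables. -/
def Ctx.Scoped (Γ : Ctx) : Prop := ∀ x A, Γ.Mem x A → A.vars ⊆ Γ.vars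

/-- What a derivable judgment says about variables. -/
def Judgment.Scoped : Judgment → Prop
  | .ctx Γ => Γ.Scoped
  | .ty Γ A => Γ.Scoped ∧ A.vars ⊆ Γ.vars
  | .tm Γ t A => Γ.Scoped ∧ t.vars ⊆ Γ.vars ∧ A.vars ⊆ Γ.vars
  | .sub Δ γ Γ => Δ.Scoped ∧ γ.vars ⊆ Δ.vars ∧ γ.dom = Γ.vars
  | .ctxEq Γ Γ' => Γ.vars = Γ'.vars ∧ Γ.idSub = Γ'.idSub
  | .tyEq Γ A B => A.vars ⊆ Γ.vars ∧ B.vars ⊆ Γ.vars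
  | .tmEq Γ t u A => A.vars ⊆ Γ.vars ∧ t.vars ⊆ Γ.vars ∧ u.vars ⊆ Γ.vars
  | .subEq Δ γ γ' Γ => (γ.vars ⊆ Δ.vars ∧ γ'.vars ⊆ Δ.vars) ∧ γ.dom = Γ.vars ∧ γ'.dom = Γ.vars

theorem Der.scoped {J : Judgment} (h : Der J) : J.Scoped := by
  induction h with
  | ec => exact fun _ _ h => h.elim
  | @ce Γ x A hA hx ih =>
    intro y B h
    refine Finset.Subset.trans ?_ (Finset.subset_insert x Γ.vars)
    rcases h with ⟨_, rfl⟩ | h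
    · exact ih.2
    · exact ih.1 _ _ h
  | unit_intro _ ih => exact ⟨ih, by simp [Ty.vars]⟩
  | hom_intro _ _ _ ih ih₁ ih₂ =>
    exact ⟨ih.1, Finset.union_subset (Finset.union_subset ih.2 ih₁.2.1) ih₂.2.1⟩
  | var _ hx ih =>
    exact ⟨ih, by simpa [Tm.vars] using hx.mem_vars, ih _ _ hx⟩
  | tt_intro _ ih => exact ⟨ih, by simp [Tm.vars], by simp [Ty.vars]⟩
  | con_intro hA _ ih =>
    refine ⟨ih.1, ih.2.1, (Ty.vars_subst _ ?_).trans ih.2.1⟩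
    rw [ih.2.2, vars_desusp, vars_desusp_ty]
    exact hA.scoped
  | conv _ _ ih₁ ih₂ => exact ⟨ih₁.1, ih₁.2.1, ih₂.2⟩
  | es _ ih => exact ⟨ih, by simp [Sub.vars], rfl⟩
  | se _ _ _ _ ih₁ _ ih₃ =>
    exact ⟨ih₁.1, Finset.union_subset ih₁.2.1 ih₃.2.1, by simp [Sub.dom, Ctx.vars, ih₁.2.2]⟩
  | eta _ _ ih₁ ih₂ => exact ⟨ih₁.2.2, ih₁.2.1, ih₂.2.1⟩
  | ty_refl _ ih => exact ⟨ih.2, ih.2⟩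
  | ty_symm _ ih => exact ⟨ih.2, ih.1⟩
  | ty_trans _ _ ih₁ ih₂ => exact ⟨ih₁.1, ih₂.2⟩
  | hom_congr _ _ _ ih ih₁ ih₂ =>
    exact ⟨Finset.union_subset (Finset.union_subset ih.1 ih₁.2.1) ih₂.2.1,
      Finset.union_subset (Finset.union_subset ih.2 ih₁.2.2) ih₂.2.2⟩
  | tm_refl _ ih => exact ⟨ih.2.2, ih.2.1, ih.2.1⟩
  | tm_symm _ ih => exact ⟨ih.1, ih.2.2, ih.2.1⟩
  | tm_trans _ _ ih₁ ih₂ => exact ⟨ih₁.1, ih₁.2.1, ih₂.2.2⟩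
  | tm_conv _ _ ih₁ ih₂ => exact ⟨ih₂.2, ih₁.2⟩
  | con_congr hA _ ih =>
    refine ⟨(Ty.vars_subst _ ?_).trans ih.1.1, ih.1.1, ih.1.2⟩
    rw [ih.2.1, vars_desusp, vars_desusp_ty]
    exact hA.scoped
  | sub_refl _ ih => exact ⟨⟨ih.2.1, ih.2.1⟩, ih.2.2, ih.2.2⟩
  | sub_symm _ ih => exact ⟨ih.1.symm, ih.2.symm⟩
  | sub_trans _ _ ih₁ ih₂ => exact ⟨⟨ih₁.1.1, ih₂.1.2⟩, ih₁.2.1, ih₂.2.2⟩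
  | se_congr _ _ _ _ ih₁ _ ih₃ =>
    exact ⟨⟨Finset.union_subset ih₁.1.1 ih₃.2.1, Finset.union_subset ih₁.1.2 ih₃.2.2⟩,
      by simp [Sub.dom, Ctx.vars, ih₁.2.1], by simp [Sub.dom, Ctx.vars, ih₁.2.2]⟩
  | ec_congr => exact ⟨rfl, rfl⟩
  | ce_congr _ _ _ ih _ =>
    exact ⟨by simp only [Ctx.vars, ih.1], by simp only [Ctx.idSub, ih.2]⟩

/-- The validity of contexts presupposed by a judgment. -/
def Judgment.Presup : Judgment → Prop
  | .ctx Γ => Der (.ctx Γ)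
  | .ty Γ _ => Der (.ctx Γ)
  | .tm Γ _ _ => Der (.ctx Γ)
  | .sub Δ _ Γ => Der (.ctx Δ) ∧ Der (.ctx Γ)
  | _ => True

theorem Der.presup {J : Judgment} (h : Der J) : J.Presup := by
  induction h with
  | ec => exact .ec
  | ce hA hx _ => exact .ce hA hx
  | unit_intro _ ih => exact ih
  | hom_intro _ _ _ ih _ _ => exact ih
  | var h _ _ => exact h
  | tt_intro h _ => exact h
  | con_intro _ _ ih => exact ih.1
  | conv _ _ ih _ => exact ih
  | es h _ => exact ⟨h, .ec⟩
  | se _ hA hx _ ih _ _ => exact ⟨ih.1, .ce hA hx⟩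
  | _ => trivial

/-- The validity of the judgment in larger contexts. -/
def Judgment.Weaken : Judgment → Prop
  | .ty Γ A => ∀ Γ', (∀ x A, Γ.Mem x A → Γ'.Mem x A) → Der (.ctx Γ') → Der (.ty Γ' A)
  | .tm Γ t A => ∀ Γ', (∀ x A, Γ.Mem x A → Γ'.Mem x A) → Der (.ctx Γ') → Der (.tm Γ' t A)
  | .sub Δ γ Γ => ∀ Δ', (∀ x A, Δ.Mem x A → Δ'.Mem x A) → Der (.ctx Δ') → Der (.sub Δ' γ Γ)
  | .tyEq Γ A B => ∀ Γ', (∀ x A, Γ.Mem x A → Γ'.Mem x A) → Der (.ctx Γ') → Der (.tyEq Γ' A B)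
  | .tmEq Γ t u A =>
      ∀ Γ', (∀ x A, Γ.Mem x A → Γ'.Mem x A) → Der (.ctx Γ') → Der (.tmEq Γ' t u A)
  | .subEq Δ γ γ' Γ =>
      ∀ Δ', (∀ x A, Δ.Mem x A → Δ'.Mem x A) → Der (.ctx Δ') → Der (.subEq Δ' γ γ' Γ)
  | _ => True

theorem Der.weaken {J : Judgment} (h : Der J) : J.Weaken := by
  induction h with
  | ec => trivial
  | ce => trivial
  | unit_intro _ _ => exact fun _ _ h => .unit_intro h
  | hom_intro _ _ _ ih ih₁ ih₂ =>
    exact fun _ h h' => .hom_intro (ih _ h h') (ih₁ _ h h') (ih₂ _ h h')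
  | var _ hx _ => exact fun _ h h' => .var h' (h _ _ hx)
  | tt_intro _ _ => exact fun _ _ h => .tt_intro h
  | con_intro hA _ ih => exact fun _ h h' => .con_intro hA (ih _ h h')
  | conv _ _ ih₁ ih₂ => exact fun _ h h' => .conv (ih₁ _ h h') (ih₂ _ h h')
  | es _ _ => exact fun _ _ h => .es h
  | se _ hA hx _ ih₁ _ ih₃ => exact fun _ h h' => .se (ih₁ _ h h') hA hx (ih₃ _ h h')
  | eta _ _ ih₁ ih₂ => exact fun _ h h' => .eta (ih₁ _ h h') (ih₂ _ h h')
  | ty_refl _ ih => exact fun _ h h' => .ty_refl (ih _ h h')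
  | ty_symm _ ih => exact fun _ h h' => .ty_symm (ih _ h h')
  | ty_trans _ _ ih₁ ih₂ => exact fun _ h h' => .ty_trans (ih₁ _ h h') (ih₂ _ h h')
  | hom_congr _ _ _ ih ih₁ ih₂ =>
    exact fun _ h h' => .hom_congr (ih _ h h') (ih₁ _ h h') (ih₂ _ h h')
  | tm_refl _ ih => exact fun _ h h' => .tm_refl (ih _ h h')
  | tm_symm _ ih => exact fun _ h h' => .tm_symm (ih _ h h')
  | tm_trans _ _ ih₁ ih₂ => exact fun _ h h' => .tm_trans (ih₁ _ h h') (ih₂ _ h h')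
  | tm_conv _ _ ih₁ ih₂ => exact fun _ h h' => .tm_conv (ih₁ _ h h') (ih₂ _ h h')
  | con_congr hA _ ih => exact fun _ h h' => .con_congr hA (ih _ h h')
  | sub_refl _ ih => exact fun _ h h' => .sub_refl (ih _ h h')
  | sub_symm _ ih => exact fun _ h h' => .sub_symm (ih _ h h')
  | sub_trans _ _ ih₁ ih₂ => exact fun _ h h' => .sub_trans (ih₁ _ h h') (ih₂ _ h h')
  | se_congr _ hA hx _ ih₁ _ ih₃ =>
    exact fun _ h h' => .se_congr (ih₁ _ h h') hA hx (ih₃ _ h h')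
  | ec_congr => trivial
  | ce_congr => trivial

theorem Der.sub_get {Δ Γ : Ctx} {γ : Sub} (hΓ : Der (.ctx Γ)) {x : ℕ} {A : Ty}
    (h : Der (.sub Δ γ Γ)) (hx : Γ.Mem x A) : Der (.tm Δ (γ.get x) (A.subst γ)) := by
  induction Γ using Ctx.vars.induct generalizing γ with
  | case1 => exact hx.elim
  | case2 Γ y B ih =>
    cases hΓ with | ce hB hy =>
    cases h with | @se _ _ γ _ _ t hγ _ _ ht =>
    rcases hx with ⟨rfl, rfl⟩ | hx
    · rw [Ty.subst_cons _ (fun h => hy (hB.scoped.2 h))]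
      simpa [Sub.get] using ht
    · have hne : x ≠ y := by rintro rfl; exact hy hx.mem_vars
      rw [Ty.subst_cons _ (fun h => hy (hB.scoped.1 _ _ hx h))]
      simpa [Sub.get, hne] using ih hB.presup hγ hx

/-- The stability of the judgment under substitution. -/
def Judgment.Subst : Judgment → Prop
  | .ty Γ A => ∀ Δ γ, Der (.sub Δ γ Γ) → Der (.ty Δ (A.subst γ))
  | .tm Γ t A => ∀ Δ γ, Der (.sub Δ γ Γ) → Der (.tm Δ (t.subst γ) (A.subst γ))
  | .sub Γ δ Θ => ∀ Δ γ, Der (.sub Δ γ Γ) → Der (.sub Δ (δ.comp γ) Θ)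
  | .tyEq Γ A B => ∀ Δ γ, Der (.sub Δ γ Γ) → Der (.tyEq Δ (A.subst γ) (B.subst γ))
  | .tmEq Γ t u A =>
      ∀ Δ γ, Der (.sub Δ γ Γ) → Der (.tmEq Δ (t.subst γ) (u.subst γ) (A.subst γ))
  | .subEq Γ δ δ' Θ => ∀ Δ γ, Der (.sub Δ γ Γ) → Der (.subEq Δ (δ.comp γ) (δ'.comp γ) Θ)
  | _ => True

theorem Der.subst {J : Judgment} (h : Der J) : J.Subst := by
  induction h with
  | ec => trivial
  | ce => trivial
  | unit_intro _ _ => exact fun _ _ h => .unit_intro h.presup.1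
  | hom_intro _ _ _ ih ih₁ ih₂ =>
    exact fun _ _ h => .hom_intro (ih _ _ h) (ih₁ _ _ h) (ih₂ _ _ h)
  | var hΓ hx _ => exact fun _ _ h => Der.sub_get hΓ h hx
  | tt_intro _ _ => exact fun _ _ h => .tt_intro h.presup.1
  | con_intro hA hγ ih =>
    intro _ _ h
    rw [Ty.subst_subst _ (by rw [hγ.scoped.2.2, vars_desusp, vars_desusp_ty]; exact hA.scoped)]
    exact .con_intro hA (ih _ _ h)
  | conv _ _ ih₁ ih₂ => exact fun _ _ h => .conv (ih₁ _ _ h) (ih₂ _ _ h)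
  | es _ _ => exact fun _ _ h => .es h.presup.1
  | se hγ hA hx _ ih₁ _ ih₃ =>
    intro _ _ h
    refine .se (ih₁ _ _ h) hA hx ?_
    rw [← Ty.subst_subst _ (by rw [hγ.scoped.2.2]; exact hA.scoped.2)]
    exact ih₃ _ _ h
  | eta _ _ ih₁ ih₂ => exact fun _ _ h => .eta (ih₁ _ _ h) (ih₂ _ _ h)
  | ty_refl _ ih => exact fun _ _ h => .ty_refl (ih _ _ h)
  | ty_symm _ ih => exact fun _ _ h => .ty_symm (ih _ _ h)
  | ty_trans _ _ ih₁ ih₂ => exact fun _ _ h => .ty_trans (ih₁ _ _ h) (ih₂ _ _ h)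
  | hom_congr _ _ _ ih ih₁ ih₂ =>
    exact fun _ _ h => .hom_congr (ih _ _ h) (ih₁ _ _ h) (ih₂ _ _ h)
  | tm_refl _ ih => exact fun _ _ h => .tm_refl (ih _ _ h)
  | tm_symm _ ih => exact fun _ _ h => .tm_symm (ih _ _ h)
  | tm_trans _ _ ih₁ ih₂ => exact fun _ _ h => .tm_trans (ih₁ _ _ h) (ih₂ _ _ h)
  | tm_conv _ _ ih₁ ih₂ => exact fun _ _ h => .tm_conv (ih₁ _ _ h) (ih₂ _ _ h)
  | con_congr hA hγ ih =>
    intro _ _ h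
    rw [Ty.subst_subst _ (by rw [hγ.scoped.2.1, vars_desusp, vars_desusp_ty]; exact hA.scoped)]
    exact .con_congr hA (ih _ _ h)
  | sub_refl _ ih => exact fun _ _ h => .sub_refl (ih _ _ h)
  | sub_symm _ ih => exact fun _ _ h => .sub_symm (ih _ _ h)
  | sub_trans _ _ ih₁ ih₂ => exact fun _ _ h => .sub_trans (ih₁ _ _ h) (ih₂ _ _ h)
  | se_congr hγ hA hx _ ih₁ _ ih₃ =>
    intro _ _ h
    refine .se_congr (ih₁ _ _ h) hA hx ?_
    rw [← Ty.subst_subst _ (by rw [hγ.scoped.2.1]; exact hA.scoped.2)]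
    exact ih₃ _ _ h
  | ec_congr => trivial
  | ce_congr => trivial

theorem Der.idSub {Γ : Ctx} (h : Der (.ctx Γ)) : Der (.sub Γ Γ.idSub Γ) := by
  induction Γ using Ctx.vars.induct with
  | case1 => exact .es h
  | case2 Γ x A ih =>
    have hΓ := h
    cases h with | ce hA hx =>
    refine .se ((ih hA.presup).weaken _ (fun _ _ => Or.inr) hΓ) hA hx ?_
    rw [Ty.subst_idSub]
    exact .var hΓ (Or.inl ⟨rfl, rfl⟩)

theorem Ctx.vars_idSub (Γ : Ctx) : Γ.idSub.vars = Γ.vars := by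
  induction Γ using Ctx.vars.induct with
  | case1 => rfl
  | case2 Γ x A ih => simp [Ctx.idSub, Sub.vars, Ctx.vars, Tm.vars, ih]

theorem Der.idSub_comp {Δ Γ : Ctx} {γ : Sub} (h : Der (.sub Δ γ Γ)) : Γ.idSub.comp γ = γ := by
  induction Γ using Ctx.vars.induct generalizing γ with
  | case1 => cases h; rfl
  | case2 Γ x A ih =>
    cases h with | @se _ _ γ _ _ t hγ _ hx ht =>
    simp [Ctx.idSub, Sub.comp, Tm.subst, Sub.get,
      Sub.comp_cons Γ.idSub (x := x) (by rwa [Ctx.vars_idSub]), ih hγ]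

/-! ### Normal forms -/

/-- The variables of type `unit` of a context. -/
def Ctx.unitVars : Ctx → Finset ℕ
  | .nil => ∅
  | .cons Γ x .unit => insert x Γ.unitVars
  | .cons Γ _ (.hom _ _ _) => Γ.unitVars

mutual
/-- The normal form of a type in a context whose variables of type `unit` are those of `U`. -/
def Ty.nf (U : Finset ℕ) : Ty → Ty
  | .unit => .unit
  | .hom A t u => .hom (A.nf U) (t.nf U) (u.nf U)
/-- The normal form of a term: the variables of type `unit` are replaced by `()`. -/
def Tm.nf (U : Finset ℕ) : Tm → Tm
  | .var x => if x ∈ U then .tt else .var x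
  | .tt => .tt
  | .con k Θ A γ => .con k Θ A (γ.nf U)
/-- The normal form of a substitution. -/
def Sub.nf (U : Finset ℕ) : Sub → Sub
  | .nil => .nil
  | .cons γ x t => .cons (γ.nf U) x (t.nf U)
end

/-- The normal form of a context. -/
def Ctx.nf : Ctx → Ctx
  | .nil => .nil
  | .cons Γ x A => .cons Γ.nf x (A.nf Γ.unitVars)

/-- The terms of type `unit`, recognised on the raw syntax. -/
def Tm.IsUnit (U : Finset ℕ) : Tm → Prop
  | .var x => x ∈ U
  | .tt => True
  | .con _ _ _ _ => False

theorem Ctx.unitVars_subset (Γ : Ctx) : Γ.unitVars ⊆ Γ.vars := by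
  induction Γ using Ctx.unitVars.induct with
  | case1 => simp [Ctx.unitVars]
  | case2 Γ x ih => exact Finset.insert_subset_insert _ ih
  | case3 Γ x A t u ih => exact ih.trans (Finset.subset_insert _ _)

theorem Der.mem_unitVars {Γ : Ctx} (h : Der (.ctx Γ)) {x : ℕ} {A : Ty} (hx : Γ.Mem x A) :
    x ∈ Γ.unitVars ↔ A = .unit := by
  induction Γ using Ctx.unitVars.induct with
  | case1 => exact hx.elim
  | case2 Γ y ih =>
    cases h with | ce hB hy =>
    rcases hx with ⟨rfl, rfl⟩ | hx
    · simp [Ctx.unitVars]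
    · have hne : x ≠ y := by rintro rfl; exact hy hx.mem_vars
      simp [Ctx.unitVars, hne, ih hB.presup hx]
  | case3 Γ y B t u ih =>
    cases h with | ce hB hy =>
    rcases hx with ⟨rfl, rfl⟩ | hx
    · simp only [Ctx.unitVars, reduceCtorEq, iff_false]
      exact fun h => hy (Ctx.unitVars_subset _ h)
    · simpa [Ctx.unitVars] using ih hB.presup hx

theorem desusp_adm_ne {k : CaTT.Kind} {Θ : CaTT.Ctx} {A : CaTT.Ty} {γ : Sub}
    (h : CaTT.Der (.adm k Θ A)) : A.desusp.subst γ ≠ .unit := by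
  cases h <;> simp [CaTT.Ty.desusp, Ty.subst]

/-- What a derivable judgment says about the terms of type `unit`. -/
def Judgment.UnitInv : Judgment → Prop
  | .tm Γ t A => A = .unit ↔ t.IsUnit Γ.unitVars
  | .tyEq _ A B => A = .unit ↔ B = .unit
  | _ => True

theorem Der.unitInv {J : Judgment} (h : Der J) : J.UnitInv := by
  induction h with
  | var h hx _ => exact (h.mem_unitVars hx).symm
  | tt_intro _ _ => simp [Judgment.UnitInv, Tm.IsUnit]
  | con_intro hA _ _ => simp [Judgment.UnitInv, Tm.IsUnit, desusp_adm_ne hA]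
  | conv _ _ ih₁ ih₂ => exact ih₂.symm.trans ih₁
  | ty_refl _ _ => exact Iff.rfl
  | ty_symm _ ih => exact ih.symm
  | ty_trans _ _ ih₁ ih₂ => exact ih₁.trans ih₂
  | hom_congr => simp [Judgment.UnitInv]
  | _ => trivial

theorem Tm.IsUnit.nf {U : Finset ℕ} {t : Tm} (h : t.IsUnit U) : t.nf U = .tt := by
  cases t with
  | var x => exact if_pos h
  | tt => rfl
  | con => exact h.elim

/-- Every derivable expression is definitionally equal to its normal form. -/
def Judgment.NfEq : Judgment → Prop
  | .ty Γ A => Der (.tyEq Γ A (A.nf Γ.unitVars))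
  | .tm Γ t A => Der (.tmEq Γ t (t.nf Γ.unitVars) A)
  | .sub Δ γ Γ => Der (.subEq Δ γ (γ.nf Δ.unitVars) Γ)
  | _ => True

theorem Der.nfEq {J : Judgment} (h : Der J) : J.NfEq := by
  induction h with
  | unit_intro h _ => exact .ty_refl (.unit_intro h)
  | hom_intro _ _ _ ih ih₁ ih₂ => exact .hom_congr ih ih₁ ih₂
  | @var Γ x A h hx _ =>
    simp only [Judgment.NfEq, Tm.nf]
    split_ifs with hU
    · obtain rfl := (h.mem_unitVars hx).1 hU
      exact .eta (.var h hx) (.tt_intro h)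
    · exact .tm_refl (.var h hx)
  | tt_intro h _ => exact .tm_refl (.tt_intro h)
  | con_intro hA _ ih => exact .con_congr hA ih
  | conv _ h ih _ => exact .tm_conv ih h
  | es h _ => exact .sub_refl (.es h)
  | se _ hA hx _ ih₁ _ ih₃ => exact .se_congr ih₁ hA hx ih₃
  | _ => trivial

/-- Definitionally equal expressions have the same normal form. -/
def Judgment.EqNf : Judgment → Prop
  | .tyEq Γ A B => A.nf Γ.unitVars = B.nf Γ.unitVars
  | .tmEq Γ t u _ => t.nf Γ.unitVars = u.nf Γ.unitVars
  | .subEq Δ γ γ' _ => γ.nf Δ.unitVars = γ'.nf Δ.unitVars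
  | .ctxEq Γ Γ' => Γ.nf = Γ'.nf ∧ Γ.unitVars = Γ'.unitVars
  | _ => True

theorem Der.eqNf {J : Judgment} (h : Der J) : J.EqNf := by
  induction h with
  | eta h₁ h₂ _ _ => exact (h₁.unitInv.1 rfl).nf.trans (h₂.unitInv.1 rfl).nf.symm
  | ty_refl _ _ => exact rfl
  | ty_symm _ ih => exact ih.symm
  | ty_trans _ _ ih₁ ih₂ => exact ih₁.trans ih₂
  | hom_congr _ _ _ ih ih₁ ih₂ =>
    simp only [Judgment.EqNf] at ih ih₁ ih₂
    simp only [Judgment.EqNf, Ty.nf, ih, ih₁, ih₂]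
  | tm_refl _ _ => exact rfl
  | tm_symm _ ih => exact ih.symm
  | tm_trans _ _ ih₁ ih₂ => exact ih₁.trans ih₂
  | tm_conv _ _ ih _ => exact ih
  | con_congr _ _ ih =>
    simp only [Judgment.EqNf] at ih
    simp only [Judgment.EqNf, Tm.nf, ih]
  | sub_refl _ _ => exact rfl
  | sub_symm _ ih => exact ih.symm
  | sub_trans _ _ ih₁ ih₂ => exact ih₁.trans ih₂
  | se_congr _ _ _ _ ih₁ _ ih₃ =>
    simp only [Judgment.EqNf] at ih₁ ih₃
    simp only [Judgment.EqNf, Sub.nf, ih₁, ih₃]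
  | ec_congr => exact ⟨rfl, rfl⟩
  | @ce_congr Γ Γ' x A A' _ hA _ ih ih₂ =>
    simp only [Judgment.EqNf] at ih ih₂
    refine ⟨by simp only [Ctx.nf, ih.1, ih₂, ← ih.2], ?_⟩
    have := hA.unitInv
    cases A <;> cases A' <;> simp [Judgment.UnitInv] at this <;> simp [Ctx.unitVars, ih.2]
  | _ => trivial

theorem Der.tyEq_of_nf {Γ : Ctx} {A B : Ty} (hA : Der (.ty Γ A)) (hB : Der (.ty Γ B))
    (h : A.nf Γ.unitVars = B.nf Γ.unitVars) : Der (.tyEq Γ A B) :=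
  .ty_trans hA.nfEq (h ▸ .ty_symm hB.nfEq)

theorem Der.subEq_of_nf {Δ Γ : Ctx} {γ γ' : Sub} (hγ : Der (.sub Δ γ Γ))
    (hγ' : Der (.sub Δ γ' Γ)) (h : γ.nf Δ.unitVars = γ'.nf Δ.unitVars) :
    Der (.subEq Δ γ γ' Γ) :=
  .sub_trans hγ.nfEq (h ▸ .sub_symm hγ'.nfEq)

theorem Der.ctxEq_idSub {Γ Γ' : Ctx} (h : Der (.ctxEq Γ Γ')) (hΓ : Der (.ctx Γ))
    (hΓ' : Der (.ctx Γ')) : Der (.sub Γ Γ.idSub Γ') ∧ Der (.sub Γ' Γ.idSub Γ) := by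
  induction Γ using Ctx.vars.induct generalizing Γ' with
  | case1 => cases h; exact ⟨.es hΓ, .es hΓ⟩
  | case2 Γ x A ih =>
    cases h with | @ce_congr _ Γ' _ _ A' h hA hx =>
    have kΓ := hΓ
    have kΓ' := hΓ'
    cases hΓ with | ce iA _ =>
    cases hΓ' with | ce iA' hx' =>
    obtain ⟨h₁, h₂⟩ := ih h iA.presup iA'.presup
    have hA' := hA.subst _ _ h₂
    rw [Ty.subst_idSub, Ty.subst_idSub] at hA'
    constructor
    · refine .se (h₁.weaken _ (fun _ _ => Or.inr) kΓ) iA' hx' ?_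
      rw [Ty.subst_idSub]
      exact .conv (.var kΓ (Or.inl ⟨rfl, rfl⟩)) (hA.weaken _ (fun _ _ => Or.inr) kΓ)
    · refine .se (h₂.weaken _ (fun _ _ => Or.inr) kΓ') iA hx ?_
      rw [Ty.subst_idSub]
      exact .conv (.var kΓ' (Or.inl ⟨rfl, rfl⟩))
        (.ty_symm (hA'.weaken _ (fun _ _ => Or.inr) kΓ'))

theorem Der.ctxEq_of_nf {Γ Γ' : Ctx} (hΓ : Der (.ctx Γ)) (hΓ' : Der (.ctx Γ'))
    (h : Γ.nf = Γ'.nf) : Der (.ctxEq Γ Γ') := by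
  induction Γ using Ctx.vars.induct generalizing Γ' with
  | case1 =>
    cases Γ' with
    | nil => exact .ec_congr
    | cons => simp [Ctx.nf] at h
  | case2 Γ x A ih =>
    cases Γ' with
    | nil => simp [Ctx.nf] at h
    | cons Γ' x' A' =>
      simp only [Ctx.nf, Ctx.cons.injEq] at h
      obtain ⟨h, rfl, h'⟩ := h
      cases hΓ with | ce hA hx =>
      cases hΓ' with | ce hA' hx' =>
      have e := ih hA.presup hA'.presup h
      have iA := hA'.subst _ _ (e.ctxEq_idSub hA.presup hA'.presup).1
      rw [Ty.subst_idSub] at iA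
      exact .ce_congr e (hA.tyEq_of_nf iA (h'.trans (by rw [e.eqNf.2]))) hx

mutual
theorem Ty.nf_subst {U : Finset ℕ} {δ δ' : Sub} (h : δ.nf U = δ'.nf U) :
    (A : Ty) → (A.subst δ).nf U = (A.subst δ').nf U
  | .unit => rfl
  | .hom A t u => by
    simp only [Ty.subst, Ty.nf, Ty.nf_subst h A, Tm.nf_subst h t, Tm.nf_subst h u]
theorem Tm.nf_subst {U : Finset ℕ} {δ δ' : Sub} (h : δ.nf U = δ'.nf U) :
    (t : Tm) → (t.subst δ).nf U = (t.subst δ').nf U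
  | .var x => by
    simp only [Tm.subst]
    induction δ using Sub.dom.induct generalizing δ' with
    | case1 =>
      cases δ' with
      | nil => rfl
      | cons => simp [Sub.nf] at h
    | case2 δ y t ih =>
      cases δ' with
      | nil => simp [Sub.nf] at h
      | cons δ' y' t' =>
        simp only [Sub.nf, Sub.cons.injEq] at h
        obtain ⟨h, rfl, h'⟩ := h
        simp only [Sub.get]
        split_ifs
        · exact h'
        · exact ih h
  | .tt => rfl
  | .con k Θ A γ => by simp only [Tm.subst, Tm.nf, Sub.nf_comp h γ]
theorem Sub.nf_comp {U : Finset ℕ} {δ δ' : Sub} (h : δ.nf U = δ'.nf U) :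
    (γ : Sub) → (γ.comp δ).nf U = (γ.comp δ').nf U
  | .nil => rfl
  | .cons γ x t => by simp only [Sub.comp, Sub.nf, Sub.nf_comp h γ, Tm.nf_subst h t]
end

end MCaTT

namespace MCaTT

/-- The valid contexts of `MCaTT`. -/
structure ValidCtx : Type where
  ctx : Ctx
  der : Der (.ctx ctx)

theorem ValidCtx.ctxEq_iff (Γ Γ' : ValidCtx) :
    Der (.ctxEq Γ.ctx Γ'.ctx) ↔ Γ.ctx.nf = Γ'.ctx.nf :=
  ⟨fun h => h.eqNf.1, Γ.der.ctxEq_of_nf Γ'.der⟩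

/-- Definitional equality of contexts. -/
instance ValidCtx.setoid : Setoid ValidCtx where
  r Γ Γ' := Der (.ctxEq Γ.ctx Γ'.ctx)
  iseqv := by
    simp only [ValidCtx.ctxEq_iff]
    exact ⟨fun _ => rfl, fun h => h.symm, fun h h' => h.trans h'⟩

theorem Der.sub_conv {Δ Δ' Γ Γ' : ValidCtx} {γ : Sub} (h : Der (.sub Δ.ctx γ Γ.ctx))
    (hΔ : Der (.ctxEq Δ.ctx Δ'.ctx)) (hΓ : Der (.ctxEq Γ.ctx Γ'.ctx)) :
    Der (.sub Δ'.ctx γ Γ'.ctx) := by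
  have h₁ := h.subst _ _ (hΔ.ctxEq_idSub Δ.der Δ'.der).2
  rw [Sub.comp_idSub] at h₁
  have h₂ := (hΓ.ctxEq_idSub Γ.der Γ'.der).1.subst _ _ h₁
  rwa [h₁.idSub_comp] at h₂

end MCaTT

/-- The objects of the syntactic category of `MCaTT`: the valid contexts up to definitional
equality. -/
def SynMCaTT : Type := Quotient MCaTT.ValidCtx.setoid

namespace SynMCaTT

open MCaTT

/-- The object given by a valid context. -/
def mk (Γ : Ctx) (h : Der (.ctx Γ)) : SynMCaTT := Quotient.mk _ ⟨Γ, h⟩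

/-- `a.IsSub γ b`: the raw substitution `γ` is valid from `a` to `b`. -/
def IsSub (a : SynMCaTT) (γ : Sub) (b : SynMCaTT) : Prop :=
  ∃ (Δ Γ : Ctx) (hΔ : Der (.ctx Δ)) (hΓ : Der (.ctx Γ)),
    mk Δ hΔ = a ∧ mk Γ hΓ = b ∧ Der (.sub Δ γ Γ)

/-- `a.SubEq γ γ' b`: the raw substitutions `γ` and `γ'` from `a` to `b` are definitionally
equal. -/
def SubEq (a : SynMCaTT) (γ γ' : Sub) (b : SynMCaTT) : Prop :=
  ∃ (Δ Γ : Ctx) (hΔ : Der (.ctx Δ)) (hΓ : Der (.ctx Γ)),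
    mk Δ hΔ = a ∧ mk Γ hΓ = b ∧ Der (.subEq Δ γ γ' Γ)

/-- The morphisms `a ⟶ b` of the syntactic category of `MCaTT`: the valid substitutions up to
definitional equality. -/
def Hom (a b : SynMCaTT) : Type :=
  Quot fun γ γ' : {γ : Sub // a.IsSub γ b} => a.SubEq γ.1 γ'.1 b

/-- The morphism given by a valid substitution. -/
def Hom.mk {a b : SynMCaTT} (γ : Sub) (h : a.IsSub γ b) : Hom a b := Quot.mk _ ⟨γ, h⟩

theorem ctxEq_of_mk_eq {Γ Γ' : Ctx} {h : Der (.ctx Γ)} {h' : Der (.ctx Γ')}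
    (e : mk Γ h = mk Γ' h') : Der (.ctxEq Γ Γ') :=
  Quotient.exact e

theorem isSub_mk {Δ Γ : Ctx} {hΔ : Der (.ctx Δ)} {hΓ : Der (.ctx Γ)} {γ : Sub} :
    (mk Δ hΔ).IsSub γ (mk Γ hΓ) ↔ Der (.sub Δ γ Γ) :=
  ⟨fun ⟨_, _, kΔ, kΓ, e₁, e₂, h⟩ => Der.sub_conv (Δ := ⟨_, kΔ⟩) (Γ := ⟨_, kΓ⟩)
    (Δ' := ⟨_, hΔ⟩) (Γ' := ⟨_, hΓ⟩) h (ctxEq_of_mk_eq e₁) (ctxEq_of_mk_eq e₂),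
   fun h => ⟨_, _, _, _, rfl, rfl, h⟩⟩

/-- The variables of type `unit` of an object. -/
def unitVars (a : SynMCaTT) : Finset ℕ :=
  Quotient.lift (fun Γ : ValidCtx => Γ.ctx.unitVars)
    (fun _ _ h => (Der.eqNf (J := .ctxEq _ _) h).2) a

/-- The identity substitution of an object. -/
def idSub (a : SynMCaTT) : Sub :=
  Quotient.lift (fun Γ : ValidCtx => Γ.ctx.idSub)
    (fun _ _ h => (Der.scoped (J := .ctxEq _ _) h).2) a

theorem ind {P : SynMCaTT → Prop} (h : ∀ Γ hΓ, P (mk Γ hΓ)) (a : SynMCaTT) : P a :=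
  Quotient.ind (fun Γ => h Γ.ctx Γ.der) a

theorem subEq_iff {a b : SynMCaTT} {γ γ' : Sub} (h : a.IsSub γ b) (h' : a.IsSub γ' b) :
    a.SubEq γ γ' b ↔ γ.nf a.unitVars = γ'.nf a.unitVars := by
  constructor
  · rintro ⟨Δ, Γ, _, _, rfl, rfl, e⟩
    exact e.eqNf
  · induction a using ind
    induction b using ind
    rw [isSub_mk] at h h'
    exact fun e => ⟨_, _, _, _, rfl, rfl, h.subEq_of_nf h' e⟩

theorem isSub_idSub (a : SynMCaTT) : a.IsSub a.idSub a := by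
  induction a using ind with | h Γ hΓ =>
  exact isSub_mk.2 hΓ.idSub

theorem IsSub.comp {a b c : SynMCaTT} {γ δ : Sub} (hγ : b.IsSub γ c) (hδ : a.IsSub δ b) :
    a.IsSub (γ.comp δ) c := by
  induction a using ind
  induction b using ind
  induction c using ind
  rw [isSub_mk] at hγ hδ ⊢
  exact hγ.subst _ _ hδ

theorem IsSub.idSub_comp {a b : SynMCaTT} {γ : Sub} (hγ : a.IsSub γ b) :
    b.idSub.comp γ = γ := by
  induction a using ind
  induction b using ind
  rw [isSub_mk] at hγ
  exact hγ.idSub_comp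

theorem IsSub.comp_idSub {a b : SynMCaTT} {γ : Sub} (hγ : a.IsSub γ b) :
    γ.comp a.idSub = γ := by
  induction a using ind
  exact Sub.comp_idSub _ _

theorem IsSub.comp_comp {a b c d : SynMCaTT} {γ δ θ : Sub} (hθ : c.IsSub θ d)
    (hγ : b.IsSub γ c) (_hδ : a.IsSub δ b) : (θ.comp γ).comp δ = θ.comp (γ.comp δ) := by
  induction b using ind
  induction c using ind
  induction d using ind
  rw [isSub_mk] at hγ hθ
  exact Sub.comp_comp _ (by rw [hγ.scoped.2.2]; exact hθ.scoped.2.1)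

theorem SubEq.comp {a b c : SynMCaTT} {γ γ' δ δ' : Sub} (hγ : b.IsSub γ c) (hγ' : b.IsSub γ' c)
    (hδ : a.IsSub δ b) (hδ' : a.IsSub δ' b) (e : b.SubEq γ γ' c) (e' : a.SubEq δ δ' b) :
    a.SubEq (γ.comp δ) (γ'.comp δ') c := by
  rw [subEq_iff (hγ.comp hδ) (hγ'.comp hδ')]
  rw [subEq_iff hδ hδ'] at e'
  rw [← Sub.nf_comp e' γ']
  rw [subEq_iff hγ hγ'] at e
  induction a using ind
  induction b using ind
  induction c using ind
  rw [isSub_mk] at hγ hγ' hδ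
  exact ((hγ.subEq_of_nf hγ' e).subst _ _ hδ).eqNf

theorem SubEq.refl {a b : SynMCaTT} {γ : Sub} (hγ : a.IsSub γ b) : a.SubEq γ γ b :=
  (subEq_iff hγ hγ).2 rfl

/-- The composition of morphisms. -/
def Hom.comp {a b c : SynMCaTT} (f : Hom a b) (g : Hom b c) : Hom a c :=
  Quot.map₂ (fun δ γ => ⟨γ.1.comp δ.1, γ.2.comp δ.2⟩)
    (fun δ γ γ' e => SubEq.comp γ.2 γ'.2 δ.2 δ.2 e (.refl δ.2))
    (fun δ δ' γ e => SubEq.comp γ.2 γ.2 δ.2 δ'.2 (.refl γ.2) e) f g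

instance : Category SynMCaTT where
  Hom := Hom
  id a := .mk a.idSub a.isSub_idSub
  comp f g := f.comp g
  id_comp := by
    rintro a b ⟨γ, hγ⟩
    exact congrArg (Quot.mk _) (Subtype.ext hγ.comp_idSub)
  comp_id := by
    rintro a b ⟨γ, hγ⟩
    exact congrArg (Quot.mk _) (Subtype.ext hγ.idSub_comp)
  assoc := by
    rintro a b c d ⟨γ, hγ⟩ ⟨δ, hδ⟩ ⟨θ, hθ⟩
    exact congrArg (Quot.mk _) (Subtype.ext (hθ.comp_comp hδ hγ).symm)

end SynMCaTT

/-! ### The desuspension functor -/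

mutual
theorem CaTT.Ty.desusp_subst (γ : CaTT.Sub) :
    (A : CaTT.Ty) → (A.subst γ).desusp = A.desusp.subst γ.desusp
  | .obj => rfl
  | .hom A t u => by
    simp only [CaTT.Ty.subst, CaTT.Ty.desusp, MCaTT.Ty.subst, CaTT.Ty.desusp_subst γ A,
      CaTT.Tm.desusp_subst γ t, CaTT.Tm.desusp_subst γ u]
theorem CaTT.Tm.desusp_subst (γ : CaTT.Sub) :
    (t : CaTT.Tm) → (t.subst γ).desusp = t.desusp.subst γ.desusp
  | .var x => by
    simp only [CaTT.Tm.subst, CaTT.Tm.desusp, MCaTT.Tm.subst]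
    induction γ using CaTT.Sub.dom.induct with
    | case1 => rfl
    | case2 γ y t ih =>
      simp only [CaTT.Sub.get, CaTT.Sub.desusp, MCaTT.Sub.get]
      split_ifs
      · rfl
      · exact ih
  | .con k Θ A δ => by
    simp only [CaTT.Tm.subst, CaTT.Tm.desusp, MCaTT.Tm.subst, CaTT.Sub.desusp_comp γ δ]
theorem CaTT.Sub.desusp_comp (γ : CaTT.Sub) :
    (δ : CaTT.Sub) → (δ.comp γ).desusp = δ.desusp.comp γ.desusp
  | .nil => rfl
  | .cons δ x t => by
    simp only [CaTT.Sub.comp, CaTT.Sub.desusp, MCaTT.Sub.comp, CaTT.Sub.desusp_comp γ δ,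
      CaTT.Tm.desusp_subst γ t]
end

theorem CaTT.Ctx.Mem.desusp {Γ : CaTT.Ctx} {x : ℕ} {A : CaTT.Ty} (h : Γ.Mem x A) :
    Γ.desusp.Mem x A.desusp := by
  induction Γ using CaTT.Ctx.vars.induct with
  | case1 => exact h.elim
  | case2 Γ y B ih =>
    rcases h with ⟨rfl, rfl⟩ | h
    · exact Or.inl ⟨rfl, rfl⟩
    · exact Or.inr (ih h)

theorem CaTT.Ctx.exists_mem_of_desusp {Γ : CaTT.Ctx} {x : ℕ} {B : MCaTT.Ty}
    (h : Γ.desusp.Mem x B) : ∃ A : CaTT.Ty, A.desusp = B ∧ Γ.Mem x A := by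
  induction Γ using CaTT.Ctx.vars.induct with
  | case1 => exact h.elim
  | case2 Γ y A ih =>
    rcases h with ⟨rfl, rfl⟩ | h
    · exact ⟨A, rfl, Or.inl ⟨rfl, rfl⟩⟩
    · obtain ⟨C, hC, h⟩ := ih h
      exact ⟨C, hC, Or.inr h⟩

theorem CaTT.Ctx.desusp_mem_mono {Γ Δ : CaTT.Ctx} (h : ∀ x A, Γ.Mem x A → Δ.Mem x A) (x : ℕ)
    (B : MCaTT.Ty) (hx : Γ.desusp.Mem x B) : Δ.desusp.Mem x B := by
  obtain ⟨A, rfl, hA⟩ := CaTT.Ctx.exists_mem_of_desusp hx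
  exact (h _ _ hA).desusp

theorem CaTT.Ctx.desusp_idSub (Γ : CaTT.Ctx) : Γ.idSub.desusp = Γ.desusp.idSub := by
  induction Γ using CaTT.Ctx.vars.induct with
  | case1 => rfl
  | case2 Γ y B ih =>
    simp only [CaTT.Ctx.idSub, CaTT.Sub.desusp, CaTT.Ctx.desusp, MCaTT.Ctx.idSub, ih,
      CaTT.Tm.desusp]

/-- The desuspension of a judgment. -/
def CaTT.Judgment.Desusp : CaTT.Judgment → Prop
  | .ctx Γ => MCaTT.Der (.ctx Γ.desusp)
  | .ty Γ A => MCaTT.Der (.ty Γ.desusp A.desusp)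
  | .tm Γ t A => MCaTT.Der (.ty Γ.desusp A.desusp) ∧ MCaTT.Der (.tm Γ.desusp t.desusp A.desusp)
  | .sub Δ γ Γ => MCaTT.Der (.sub Δ.desusp γ.desusp Γ.desusp)
  | .adm _ Γ A => MCaTT.Der (.ctx Γ.desusp) → MCaTT.Der (.ty Γ.desusp A.desusp)

theorem MCaTT.Der.ty_of_mem {Γ : MCaTT.Ctx} (h : MCaTT.Der (.ctx Γ)) {x : ℕ} {A : MCaTT.Ty}
    (hx : Γ.Mem x A) : MCaTT.Der (.ty Γ A) := by
  induction Γ using MCaTT.Ctx.vars.induct with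
  | case1 => exact hx.elim
  | case2 Γ y B ih =>
    have hΓ := h
    cases h with | ce hB _ =>
    rcases hx with ⟨rfl, rfl⟩ | hx
    · exact hB.weaken _ (fun _ _ => Or.inr) hΓ
    · exact (ih hB.presup hx).weaken _ (fun _ _ => Or.inr) hΓ

theorem CaTT.Der.desusp {J : CaTT.Judgment} (h : CaTT.Der J) : J.Desusp := by
  induction h with
  | ec => exact .ec
  | ce _ hx ih => exact .ce ih (by rwa [MCaTT.vars_desusp])
  | obj_intro _ ih => exact .unit_intro ih
  | hom_intro _ _ ih₁ ih₂ => exact .hom_intro ih₁.1 ih₁.2 ih₂.2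
  | var _ hx ih => exact ⟨ih.ty_of_mem hx.desusp, .var ih hx.desusp⟩
  | con_intro hA _ ihA ih =>
    simp only [CaTT.Judgment.Desusp, CaTT.Ty.desusp_subst]
    exact ⟨(ihA ih.presup.2).subst _ _ ih, .con_intro hA ih⟩
  | es _ ih => exact .es ih
  | se _ _ hx _ ih ihA iht =>
    refine .se ih ihA (by rwa [MCaTT.vars_desusp]) ?_
    rw [← CaTT.Ty.desusp_subst]
    exact iht.2
  | @adm_op Γ A t u i _ _ h₁ h₂ _ _ ih₁ ih₂ =>
    intro h
    have w : ∀ x A, (Γ.src i).desusp.Mem x A → Γ.desusp.Mem x A :=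
      CaTT.Ctx.desusp_mem_mono fun _ _ => CaTT.Ctx.src_mem
    have w' : ∀ x A, (Γ.tgt i).desusp.Mem x A → Γ.desusp.Mem x A :=
      CaTT.Ctx.desusp_mem_mono fun _ _ => CaTT.Ctx.tgt_mem
    exact .hom_intro (ih₁.1.weaken _ w h) (ih₁.2.weaken _ w h) (ih₂.2.weaken _ w' h)
  | adm_coh _ _ _ _ _ ih₁ ih₂ => exact fun _ => .hom_intro ih₁.1 ih₁.2 ih₂.2

/-- The desuspension functor. -/
def desuspension : SynCaTT ⥤ SynMCaTT where
  obj Γ := SynMCaTT.mk Γ.ctx.desusp Γ.der.desusp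
  map f := SynMCaTT.Hom.mk f.sub.desusp (SynMCaTT.isSub_mk.2 f.der.desusp)
  map_id Γ := congrArg (Quot.mk _) (Subtype.ext Γ.ctx.desusp_idSub)
  map_comp f g := congrArg (Quot.mk _) (Subtype.ext (CaTT.Sub.desusp_comp f.sub g.sub))

/-! ### The reduced suspension on expressions -/

/-- The substitution `•_Θ` from the reduced suspension of the desuspension of `Θ` to `Θ`. It maps
each variable `x` to the reduced suspension of the desuspension of `x`, which is the variable
`•`, i.e. `0`, when `x` has type `obj`, and is the renamed variable `x + 1` otherwise. -/
def CaTT.Ctx.red : CaTT.Ctx → CaTT.Sub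
  | .nil => .nil
  | .cons Θ x .obj => .cons Θ.red x (.var 0)
  | .cons Θ x (.hom _ _ _) => .cons Θ.red x (.var (x + 1))

mutual
/-- The reduced suspension of a type in a context whose variables of type `unit` are those of
`U`. -/
def MCaTT.Ty.susp (U : Finset ℕ) : MCaTT.Ty → CaTT.Ty
  | .unit => .obj
  | .hom A t u => .hom (A.susp U) (t.susp U) (u.susp U)
/-- The reduced suspension of a term in a context whose variables of type `unit` are those of `U`.
The fresh variable `•` is `0`, and each variable `x` is renamed to `x + 1`. Variables
of type `unit` are treated as their normal form `()`. -/
def MCaTT.Tm.susp (U : Finset ℕ) : MCaTT.Tm → CaTT.Tm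
  | .var x => if x ∈ U then .var 0 else .var (x + 1)
  | .tt => .var 0
  | .con k Θ A γ => .con k Θ A (Θ.red.comp (γ.susp U Θ.desusp.unitVars))
/-- The reduced suspension of a substitution `Δ ⊢ γ : Γ`, where `U` and `V` are the sets of
variables of type `unit` of `Δ` and `Γ`. -/
def MCaTT.Sub.susp (U V : Finset ℕ) : MCaTT.Sub → CaTT.Sub
  | .nil => .cons .nil 0 (.var 0)
  | .cons γ x t => if x ∈ V then γ.susp U V else .cons (γ.susp U V) (x + 1) (t.susp U)
end

/-- The reduced suspension of a context. -/
def MCaTT.Ctx.susp : MCaTT.Ctx → CaTT.Ctx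
  | .nil => .cons .nil 0 .obj
  | .cons Γ _ .unit => Γ.susp
  | .cons Γ x (.hom A t u) => .cons Γ.susp (x + 1) (MCaTT.Ty.susp Γ.unitVars (.hom A t u))

namespace MCaTT

mutual
theorem Ty.susp_nf (U : Finset ℕ) : (A : Ty) → (A.nf U).susp U = A.susp U
  | .unit => rfl
  | .hom A t u => by
    simp only [Ty.nf, Ty.susp, Ty.susp_nf U A, Tm.susp_nf U t, Tm.susp_nf U u]
theorem Tm.susp_nf (U : Finset ℕ) : (t : Tm) → (t.nf U).susp U = t.susp U
  | .var x => by
    simp only [Tm.nf]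
    split_ifs with h <;> simp [Tm.susp, h]
  | .tt => rfl
  | .con k Θ A γ => by simp only [Tm.nf, Tm.susp, Sub.susp_nf U Θ.desusp.unitVars γ]
theorem Sub.susp_nf (U V : Finset ℕ) : (γ : Sub) → (γ.nf U).susp U V = γ.susp U V
  | .nil => rfl
  | .cons γ x t => by simp only [Sub.nf, Sub.susp, Sub.susp_nf U V γ, Tm.susp_nf U t]
end

theorem Ctx.unitVars_nf (Γ : Ctx) : Γ.nf.unitVars = Γ.unitVars := by
  induction Γ using Ctx.unitVars.induct with
  | case1 => rfl
  | case2 Γ x ih => simp only [Ctx.nf, Ty.nf, Ctx.unitVars, ih]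
  | case3 Γ x A t u ih => simp only [Ctx.nf, Ty.nf, Ctx.unitVars, ih]

theorem Ctx.susp_nf (Γ : Ctx) : Γ.nf.susp = Γ.susp := by
  induction Γ using Ctx.unitVars.induct with
  | case1 => rfl
  | case2 Γ x ih => simp only [Ctx.nf, Ty.nf, Ctx.susp, ih]
  | case3 Γ x A t u ih =>
    have h := Ty.susp_nf Γ.unitVars (.hom A t u)
    simp only [Ty.nf] at h
    simp only [Ctx.nf, Ty.nf, Ctx.susp, ih, Ctx.unitVars_nf, h]

theorem Tm.IsUnit.susp {U : Finset ℕ} {t : Tm} (h : t.IsUnit U) : t.susp U = .var 0 := by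
  cases t with
  | var x => exact if_pos h
  | tt => rfl
  | con => exact h.elim

theorem Sub.susp_congr {U V V' : Finset ℕ} (γ : Sub) (h : ∀ x ∈ γ.dom, x ∈ V ↔ x ∈ V') :
    γ.susp U V = γ.susp U V' := by
  induction γ using Sub.dom.induct with
  | case1 => rfl
  | case2 γ x t ih =>
    have h₁ := ih fun y hy => h y (Finset.mem_insert_of_mem hy)
    simp only [Sub.susp, h₁, h x (Finset.mem_insert_self _ _)]

theorem Sub.susp_get_zero (U V : Finset ℕ) (γ : Sub) : (γ.susp U V).get 0 = .var 0 := by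
  induction γ using Sub.dom.induct with
  | case1 => rfl
  | case2 γ x t ih =>
    simp only [Sub.susp]
    split_ifs
    · exact ih
    · simpa [CaTT.Sub.get] using ih

theorem Sub.susp_get_succ {U V : Finset ℕ} {γ : Sub} {x : ℕ} (hx : x ∈ γ.dom) (hV : x ∉ V) :
    (γ.susp U V).get (x + 1) = (γ.get x).susp U := by
  induction γ using Sub.dom.induct with
  | case1 => simp [Sub.dom] at hx
  | case2 γ y t ih =>
    simp only [Sub.susp]
    by_cases hxy : x = y
    · subst hxy
      simp [hV, CaTT.Sub.get, Sub.get]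
    · have h := ih (by simpa [Sub.dom, hxy] using hx)
      split_ifs
      · simpa [Sub.get, hxy] using h
      · simpa [Sub.get, CaTT.Sub.get, hxy] using h

theorem Sub.mem_dom_susp {U V : Finset ℕ} {γ : Sub} {y : ℕ} :
    y ∈ (γ.susp U V).dom ↔ y = 0 ∨ ∃ x ∈ γ.dom, x ∉ V ∧ y = x + 1 := by
  induction γ using Sub.dom.induct with
  | case1 => simp [Sub.susp, CaTT.Sub.dom, Sub.dom]
  | case2 γ x t ih =>
    simp only [Sub.susp]
    split_ifs with h
    · rw [ih]
      simp [Sub.dom, h]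
    · simp [CaTT.Sub.dom, ih, Sub.dom, h]
      tauto

theorem unitVars_cons_obj (Θ : CaTT.Ctx) (x : ℕ) :
    (CaTT.Ctx.cons Θ x .obj).desusp.unitVars = insert x Θ.desusp.unitVars := rfl

theorem unitVars_cons_hom (Θ : CaTT.Ctx) (x : ℕ) (A : CaTT.Ty) (t u : CaTT.Tm) :
    (CaTT.Ctx.cons Θ x (.hom A t u)).desusp.unitVars = Θ.desusp.unitVars := rfl

theorem mem_vars_red {Θ : CaTT.Ctx} (hΘ : CaTT.Der (.ctx Θ)) {y : ℕ} (h : y ∈ Θ.red.vars) :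
    y = 0 ∨ ∃ x ∈ Θ.vars, x ∉ Θ.desusp.unitVars ∧ y = x + 1 := by
  induction Θ using CaTT.Ctx.red.induct with
  | case1 => simp [CaTT.Ctx.red, CaTT.Sub.vars] at h
  | case2 Θ x ih =>
    cases hΘ with | ce hA hx =>
    simp only [CaTT.Ctx.red, CaTT.Sub.vars, CaTT.Tm.vars, Finset.mem_union,
      Finset.mem_singleton] at h
    rcases h with h | h
    · rcases ih hA.presup h with h | ⟨z, hz, hz', rfl⟩
      · exact Or.inl h
      · refine Or.inr ⟨z, Finset.mem_insert_of_mem hz, ?_, rfl⟩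
        rw [unitVars_cons_obj, Finset.mem_insert, not_or]
        exact ⟨by rintro rfl; exact hx hz, hz'⟩
    · exact Or.inl h
  | case3 Θ x A t u ih =>
    cases hΘ with | ce hA hx =>
    simp only [CaTT.Ctx.red, CaTT.Sub.vars, CaTT.Tm.vars, Finset.mem_union,
      Finset.mem_singleton] at h
    rcases h with h | rfl
    · rcases ih hA.presup h with h | ⟨z, hz, hz', rfl⟩
      · exact Or.inl h
      · exact Or.inr ⟨z, Finset.mem_insert_of_mem hz, hz', rfl⟩
    · refine Or.inr ⟨x, Finset.mem_insert_self _ _, ?_, rfl⟩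
      rw [unitVars_cons_hom]
      intro hx'
      have := Ctx.unitVars_subset _ hx'
      rw [vars_desusp] at this
      exact hx this

theorem Der.get_isUnit {Δ Γ : Ctx} {γ : Sub} (h : Der (.sub Δ γ Γ)) {x : ℕ}
    (hx : x ∈ Γ.unitVars) : (γ.get x).IsUnit Δ.unitVars := by
  have hm : Γ.Mem x .unit := by
    clear h
    induction Γ using Ctx.unitVars.induct with
    | case1 => simp [Ctx.unitVars] at hx
    | case2 Γ y ih =>
      rcases Finset.mem_insert.1 hx with rfl | hx
      · exact Or.inl ⟨rfl, rfl⟩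
      · exact Or.inr (ih hx)
    | case3 Γ y A t u ih => exact Or.inr (ih hx)
  exact (Der.sub_get h.presup.2 h hm).unitInv.1 rfl

end MCaTT

theorem CaTT.Der.ty_of_mem {Γ : CaTT.Ctx} (h : CaTT.Der (.ctx Γ)) {x : ℕ} {A : CaTT.Ty}
    (hx : Γ.Mem x A) : CaTT.Der (.ty Γ A) := by
  induction Γ using CaTT.Ctx.vars.induct with
  | case1 => exact hx.elim
  | case2 Γ y B ih =>
    have hΓ := h
    cases h with | ce hB _ =>
    rcases hx with ⟨rfl, rfl⟩ | hx
    · exact hB.weaken _ (fun _ _ => Or.inr) hΓ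
    · exact (ih hB.presup hx).weaken _ (fun _ _ => Or.inr) hΓ

theorem CaTT.PsPartial.der {Γ : CaTT.Ctx} {x : ℕ} {A : CaTT.Ty} (h : CaTT.PsPartial Γ x A) :
    CaTT.Der (.ctx Γ) ∧ CaTT.Der (.tm Γ (.var x) A) := by
  induction h with
  | pss x =>
    have h : CaTT.Der (.ctx (.cons .nil x .obj)) :=
      .ce (.obj_intro .ec) (by simp [CaTT.Ctx.vars])
    exact ⟨h, .var h (Or.inl ⟨rfl, rfl⟩)⟩
  | @psd Γ f x y A _ ih =>
    refine ⟨ih.1, ?_⟩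
    cases ih.2 with | var h hx =>
    cases h.ty_of_mem hx with | hom_intro _ h => exact h
  | @pse Γ x y f A _ hy hf ih =>
    cases ih.2 with | var h hx =>
    have h₁ : CaTT.Der (.ctx (.cons Γ y A)) := .ce (h.ty_of_mem hx) hy
    have h₂ : CaTT.Der (.ctx (.cons (.cons Γ y A) f (.hom A (.var x) (.var y)))) :=
      .ce (.hom_intro (.var h₁ (Or.inr hx)) (.var h₁ (Or.inl ⟨rfl, rfl⟩))) hf
    exact ⟨h₂, .var h₂ (Or.inl ⟨rfl, rfl⟩)⟩

theorem CaTT.Der.adm_der {k : CaTT.Kind} {Γ : CaTT.Ctx} {A : CaTT.Ty}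
    (h : CaTT.Der (.adm k Γ A)) : CaTT.Der (.ctx Γ) ∧ CaTT.Der (.ty Γ A) := by
  cases h with
  | adm_op hΓ _ ht hu _ _ =>
    obtain ⟨x, hx⟩ := hΓ
    exact ⟨hx.der.1, .hom_intro (ht.weaken _ (fun _ _ => CaTT.Ctx.src_mem) hx.der.1)
      (hu.weaken _ (fun _ _ => CaTT.Ctx.tgt_mem) hx.der.1)⟩
  | adm_coh hΓ ht hu _ _ =>
    obtain ⟨x, hx⟩ := hΓ
    exact ⟨hx.der.1, .hom_intro ht hu⟩

namespace MCaTT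

/-- The compatibility of the reduced suspension with substitutions. -/
def Judgment.SuspSubst : Judgment → Prop
  | .ty Γ A => ∀ Δ γ, Der (.sub Δ γ Γ) →
      (A.subst γ).susp Δ.unitVars =
        (A.susp Γ.unitVars).subst (γ.susp Δ.unitVars Γ.unitVars)
  | .tm Γ t _ => ∀ Δ γ, Der (.sub Δ γ Γ) →
      (t.subst γ).susp Δ.unitVars =
        (t.susp Γ.unitVars).subst (γ.susp Δ.unitVars Γ.unitVars)
  | .sub Γ δ Θ => ∀ Δ γ, Der (.sub Δ γ Γ) →
      (δ.comp γ).susp Δ.unitVars Θ.unitVars =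
        (δ.susp Γ.unitVars Θ.unitVars).comp (γ.susp Δ.unitVars Γ.unitVars)
  | _ => True

theorem red_vars_subset {Θ : CaTT.Ctx} (hΘ : CaTT.Der (.ctx Θ)) {U : Finset ℕ} {γ : Sub}
    (hγ : γ.dom = Θ.vars) : Θ.red.vars ⊆ (γ.susp U Θ.desusp.unitVars).dom := by
  intro y hy
  rw [Sub.mem_dom_susp, hγ]
  exact mem_vars_red hΘ hy

theorem unitVars_cons_subset (Γ : Ctx) (x : ℕ) (A : Ty) {y : ℕ} (hy : y ≠ x) :
    y ∈ (Ctx.cons Γ x A).unitVars ↔ y ∈ Γ.unitVars := by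
  cases A <;> simp [Ctx.unitVars, hy]

theorem Sub.susp_cons {Γ : Ctx} {γ : Sub} {x : ℕ} {A : Ty} (hγ : γ.dom = Γ.vars)
    (hx : x ∉ Γ.vars) (U : Finset ℕ) :
    γ.susp U (Ctx.cons Γ x A).unitVars = γ.susp U Γ.unitVars :=
  Sub.susp_congr γ fun y hy =>
    unitVars_cons_subset Γ x A (by rintro rfl; exact hx (hγ ▸ hy))

theorem Der.suspSubst {J : Judgment} (h : Der J) : J.SuspSubst := by
  induction h with
  | unit_intro _ _ => exact fun _ _ _ => rfl
  | hom_intro _ _ _ ih ih₁ ih₂ =>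
    intro Δ γ h
    simp only [Ty.subst, Ty.susp, CaTT.Ty.subst, ih _ _ h, ih₁ _ _ h, ih₂ _ _ h]
  | @var Γ x A hΓ hx _ =>
    intro Δ γ h
    simp only [Tm.subst, Tm.susp]
    split_ifs with hU
    · rw [(h.get_isUnit hU).susp]
      exact (Sub.susp_get_zero _ _ _).symm
    · exact (Sub.susp_get_succ (by rw [h.scoped.2.2]; exact hx.mem_vars) hU).symm
  | tt_intro _ _ => exact fun _ _ _ => (Sub.susp_get_zero _ _ _).symm
  | con_intro hA hδ ih =>
    intro Δ γ h
    simp only [Tm.subst, Tm.susp, CaTT.Tm.subst, ih _ _ h]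
    rw [CaTT.Sub.comp_comp _ (red_vars_subset hA.adm_der.1
      (by rw [hδ.scoped.2.2, vars_desusp]))]
  | conv _ _ ih _ => exact ih
  | es _ _ =>
    intro Δ γ h
    simp only [Sub.comp, Sub.susp, CaTT.Sub.comp, CaTT.Tm.subst, Sub.susp_get_zero]
  | @se Γ Θ δ x A t hδ hA hx ht ih _ ih₃ =>
    intro Δ γ h
    have e₁ : (δ.comp γ).dom = Θ.vars := (hδ.subst _ _ h).scoped.2.2
    simp only [Sub.comp, Sub.susp, Sub.susp_cons e₁ hx, Sub.susp_cons hδ.scoped.2.2 hx,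
      ih _ _ h, ih₃ _ _ h]
    split_ifs <;> rfl
  | _ => trivial

theorem desusp_isUnit {Γ : CaTT.Ctx} {t : CaTT.Tm} (h : CaTT.Der (.tm Γ t .obj)) :
    t.desusp.IsUnit Γ.desusp.unitVars := h.desusp.2.unitInv.1 rfl

theorem red_get {Γ : CaTT.Ctx} (hΓ : CaTT.Der (.ctx Γ)) {x : ℕ} {A : CaTT.Ty}
    (hx : Γ.Mem x A) : Γ.red.get x = (Tm.var x).susp Γ.desusp.unitVars := by
  classical
  have main : Γ.red.get x = if A = .obj then CaTT.Tm.var 0 else CaTT.Tm.var (x + 1) := by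
    induction Γ using CaTT.Ctx.red.induct with
    | case1 => exact hx.elim
    | case2 Γ y ih =>
      cases hΓ with | ce hB hy =>
      rcases hx with ⟨rfl, rfl⟩ | hx
      · simp [CaTT.Ctx.red, CaTT.Sub.get]
      · have hne : x ≠ y := by rintro rfl; exact hy hx.mem_vars
        simpa [CaTT.Ctx.red, CaTT.Sub.get, hne] using ih hB.presup hx
    | case3 Γ y B t u ih =>
      cases hΓ with | ce hB hy =>
      rcases hx with ⟨rfl, rfl⟩ | hx
      · simp [CaTT.Ctx.red, CaTT.Sub.get]
      · have hne : x ≠ y := by rintro rfl; exact hy hx.mem_vars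
        simpa [CaTT.Ctx.red, CaTT.Sub.get, hne] using ih hB.presup hx
  rw [main, Tm.susp]
  have e : A.desusp = .unit ↔ A = .obj := by cases A <;> simp [CaTT.Ty.desusp]
  simp only [(CaTT.Der.desusp hΓ).mem_unitVars hx.desusp, e]

end MCaTT

theorem CaTT.Der.tm_ty {Γ : CaTT.Ctx} {t : CaTT.Tm} {A : CaTT.Ty}
    (h : CaTT.Der (.tm Γ t A)) : CaTT.Der (.ty Γ A) := by
  cases h with
  | var h hx => exact h.ty_of_mem hx
  | con_intro hA hγ => exact hA.adm_der.2.subst _ _ hγ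

theorem CaTT.Der.hom_inv {Γ : CaTT.Ctx} {t u : CaTT.Tm} {A : CaTT.Ty}
    (h : CaTT.Der (.ty Γ (.hom A t u))) :
    CaTT.Der (.ty Γ A) ∧ CaTT.Der (.tm Γ t A) ∧ CaTT.Der (.tm Γ u A) := by
  cases h with | hom_intro ht hu => exact ⟨ht.tm_ty, ht, hu⟩

theorem CaTT.Der.con_inv {Δ : CaTT.Ctx} {k : CaTT.Kind} {Θ : CaTT.Ctx} {A B : CaTT.Ty}
    {γ : CaTT.Sub} (h : CaTT.Der (.tm Δ (.con k Θ A γ) B)) :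
    CaTT.Der (.adm k Θ A) ∧ CaTT.Der (.sub Δ γ Θ) := by
  cases h with | con_intro hA hγ => exact ⟨hA, hγ⟩

theorem CaTT.red_comp_cons {Γ : CaTT.Ctx} (hΓ : CaTT.Der (.ctx Γ)) {x : ℕ} (hx : x ∉ Γ.vars)
    (σ : CaTT.Sub) (s : CaTT.Tm) : Γ.red.comp (.cons σ (x + 1) s) = Γ.red.comp σ := by
  refine CaTT.Sub.comp_cons _ fun h => ?_
  rcases MCaTT.mem_vars_red hΓ h with h | ⟨y, hy, _, h⟩
  · simp at h
  · obtain rfl : x = y := by omega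
    exact hx hy

mutual
theorem CaTT.Ty.subst_red {Γ : CaTT.Ctx} : (A : CaTT.Ty) → CaTT.Der (.ty Γ A) →
    A.subst Γ.red = A.desusp.susp Γ.desusp.unitVars
  | .obj, _ => rfl
  | .hom A t u, h => by
    simp only [CaTT.Ty.subst, CaTT.Ty.desusp, MCaTT.Ty.susp, CaTT.Ty.subst_red A h.hom_inv.1,
      CaTT.Tm.subst_red t A h.hom_inv.2.1, CaTT.Tm.subst_red u A h.hom_inv.2.2]
theorem CaTT.Tm.subst_red {Γ : CaTT.Ctx} : (t : CaTT.Tm) → (A : CaTT.Ty) →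
    CaTT.Der (.tm Γ t A) → t.subst Γ.red = t.desusp.susp Γ.desusp.unitVars
  | .var x, A, h => by
    cases h with | var hΓ hx =>
    exact MCaTT.red_get hΓ hx
  | .con k Θ B γ, A, h => by
    simp only [CaTT.Tm.subst, CaTT.Tm.desusp, MCaTT.Tm.susp, CaTT.Sub.comp_red γ Θ h.con_inv.2]
theorem CaTT.Sub.comp_red {Δ : CaTT.Ctx} : (γ : CaTT.Sub) → (Γ : CaTT.Ctx) →
    CaTT.Der (.sub Δ γ Γ) →
    γ.comp Δ.red = Γ.red.comp (γ.desusp.susp Δ.desusp.unitVars Γ.desusp.unitVars)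
  | .nil, Γ, h => by cases h; rfl
  | .cons γ x t, Γ, h => by
    cases h with | @se _ Γ _ _ A _ hγ hA hx ht =>
    have ih := CaTT.Sub.comp_red γ Γ hγ
    have ih' := CaTT.Tm.subst_red t _ ht
    have hx' : x ∉ Γ.desusp.vars := by rwa [MCaTT.vars_desusp]
    have e := MCaTT.Sub.susp_cons (A := A.desusp) hγ.desusp.scoped.2.2 hx' Δ.desusp.unitVars
    simp only [CaTT.Sub.comp, CaTT.Sub.desusp, MCaTT.Sub.susp, CaTT.Ctx.desusp, e, ih, ih']
    cases A with
    | obj =>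
      have hx'' : x ∈ (MCaTT.Ctx.cons Γ.desusp x .unit).unitVars := Finset.mem_insert_self _ _
      simp only [CaTT.Ty.desusp, if_pos hx'', CaTT.Ctx.red, CaTT.Sub.comp, CaTT.Tm.subst,
        MCaTT.Sub.susp_get_zero, (MCaTT.desusp_isUnit ht).susp]
    | hom A u v =>
      have hx'' : x ∉ (MCaTT.Ctx.cons Γ.desusp x (CaTT.Ty.hom A u v).desusp).unitVars :=
        fun h => hx' (MCaTT.Ctx.unitVars_subset _ h)
      rw [if_neg hx'']
      simp only [CaTT.Ctx.red, CaTT.Sub.comp, CaTT.red_comp_cons hA.presup hx, CaTT.Tm.subst,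
        CaTT.Sub.get, if_true]
end

theorem MCaTT.Ctx.susp_vars {Γ : MCaTT.Ctx} {y : ℕ} (h : y ∈ Γ.susp.vars) :
    y = 0 ∨ ∃ x ∈ Γ.vars, y = x + 1 := by
  induction Γ using MCaTT.Ctx.unitVars.induct with
  | case1 => exact Or.inl (by simpa [MCaTT.Ctx.susp, CaTT.Ctx.vars] using h)
  | case2 Γ x ih =>
    exact (ih h).imp_right fun ⟨z, hz, e⟩ => ⟨z, Finset.mem_insert_of_mem hz, e⟩
  | case3 Γ x A t u ih =>
    rcases Finset.mem_insert.1 h with rfl | h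
    · exact Or.inr ⟨x, Finset.mem_insert_self _ _, rfl⟩
    · exact (ih h).imp_right fun ⟨z, hz, e⟩ => ⟨z, Finset.mem_insert_of_mem hz, e⟩

theorem MCaTT.Ctx.susp_notMem {Γ : MCaTT.Ctx} {x : ℕ} (h : x ∉ Γ.vars) :
    x + 1 ∉ Γ.susp.vars := fun h' => by
  rcases MCaTT.Ctx.susp_vars h' with h' | ⟨y, hy, h'⟩
  · simp at h'
  · obtain rfl : x = y := by omega
    exact h hy

theorem MCaTT.Ctx.susp_mem_zero (Γ : MCaTT.Ctx) : Γ.susp.Mem 0 .obj := by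
  induction Γ using MCaTT.Ctx.unitVars.induct with
  | case1 => exact Or.inl ⟨rfl, rfl⟩
  | case2 Γ x ih => exact ih
  | case3 Γ x A t u ih => exact Or.inr ih

mutual
theorem MCaTT.Ty.susp_congr {U V : Finset ℕ} : (A : MCaTT.Ty) →
    (∀ x ∈ A.vars, x ∈ U ↔ x ∈ V) → A.susp U = A.susp V
  | .unit, _ => rfl
  | .hom A t u, h => by
    simp only [MCaTT.Ty.vars, Finset.mem_union] at h
    simp only [MCaTT.Ty.susp, MCaTT.Ty.susp_congr A fun x hx => h x (Or.inl (Or.inl hx)),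
      MCaTT.Tm.susp_congr t fun x hx => h x (Or.inl (Or.inr hx)),
      MCaTT.Tm.susp_congr u fun x hx => h x (Or.inr hx)]
theorem MCaTT.Tm.susp_congr {U V : Finset ℕ} : (t : MCaTT.Tm) →
    (∀ x ∈ t.vars, x ∈ U ↔ x ∈ V) → t.susp U = t.susp V
  | .var x, h => by
    simp only [MCaTT.Tm.susp, h x (by simp [MCaTT.Tm.vars])]
  | .tt, _ => rfl
  | .con k Θ A γ, h => by
    simp only [MCaTT.Tm.susp, MCaTT.Sub.susp_congr_left γ Θ.desusp.unitVars h]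
theorem MCaTT.Sub.susp_congr_left {U V : Finset ℕ} : (γ : MCaTT.Sub) → (W : Finset ℕ) →
    (∀ x ∈ γ.vars, x ∈ U ↔ x ∈ V) → γ.susp U W = γ.susp V W
  | .nil, _, _ => rfl
  | .cons γ x t, W, h => by
    simp only [MCaTT.Sub.vars, Finset.mem_union] at h
    simp only [MCaTT.Sub.susp, MCaTT.Sub.susp_congr_left γ W fun x hx => h x (Or.inl hx),
      MCaTT.Tm.susp_congr t fun x hx => h x (Or.inr hx)]
end

theorem MCaTT.Ty.susp_cons {Γ : MCaTT.Ctx} {x : ℕ} {A B : MCaTT.Ty} (hA : A.vars ⊆ Γ.vars)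
    (hx : x ∉ Γ.vars) :
    A.susp (MCaTT.Ctx.cons Γ x B).unitVars = A.susp Γ.unitVars :=
  MCaTT.Ty.susp_congr A fun y hy => MCaTT.unitVars_cons_subset Γ x B
    (by rintro rfl; exact hx (hA hy))

theorem MCaTT.Der.susp_mem {Γ : MCaTT.Ctx} (hΓ : MCaTT.Der (.ctx Γ)) {x : ℕ} {A : MCaTT.Ty}
    (hx : Γ.Mem x A) (hA : A ≠ .unit) : Γ.susp.Mem (x + 1) (A.susp Γ.unitVars) := by
  induction Γ using MCaTT.Ctx.unitVars.induct with
  | case1 => exact hx.elim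
  | case2 Γ y ih =>
    cases hΓ with | ce hB hy =>
    rcases hx with ⟨_, h⟩ | hx
    · exact absurd h hA
    · rw [MCaTT.Ty.susp_cons (hB.scoped.1 _ _ hx) hy]
      exact ih hB.presup hx
  | case3 Γ y B t u ih =>
    cases hΓ with | ce hB hy =>
    rcases hx with ⟨rfl, rfl⟩ | hx
    · exact Or.inl ⟨rfl, rfl⟩
    · exact Or.inr (ih hB.presup hx)

/-- The validity of the substitutions `•_Θ`. -/
theorem CaTT.Der.red {Θ : CaTT.Ctx} (hΘ : CaTT.Der (.ctx Θ))
    (h : CaTT.Der (.ctx Θ.desusp.susp)) : CaTT.Der (.sub Θ.desusp.susp Θ.red Θ) := by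
  induction Θ using CaTT.Ctx.red.induct with
  | case1 => exact .es h
  | case2 Θ x ih =>
    cases hΘ with | ce hA hx =>
    exact .se (ih hA.presup h) hA hx (.var h (MCaTT.Ctx.susp_mem_zero _))
  | case3 Θ x A t u ih =>
    have k := h
    cases hΘ with | ce hA hx =>
    cases h with | ce h _ =>
    refine .se ((ih hA.presup h.presup).weaken _ (fun _ _ => Or.inr) k) hA hx ?_
    rw [CaTT.Ty.subst_red _ hA]
    exact .var k (Or.inl ⟨rfl, rfl⟩)

/-- The reduced suspension of a judgment. -/
def MCaTT.Judgment.Susp : MCaTT.Judgment → Prop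
  | .ctx Γ => CaTT.Der (.ctx Γ.susp)
  | .ty Γ A => CaTT.Der (.ty Γ.susp (A.susp Γ.unitVars))
  | .tm Γ t A => CaTT.Der (.tm Γ.susp (t.susp Γ.unitVars) (A.susp Γ.unitVars))
  | .sub Δ γ Γ => CaTT.Der (.sub Δ.susp (γ.susp Δ.unitVars Γ.unitVars) Γ.susp)
  | _ => True

theorem MCaTT.Der.susp {J : MCaTT.Judgment} (h : MCaTT.Der J) : J.Susp := by
  induction h with
  | ec => exact .ce (.obj_intro .ec) (by simp [CaTT.Ctx.vars])
  | @ce Γ x A hA hx ih =>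
    cases A with
    | unit => exact ih.presup
    | hom A t u => exact .ce ih (MCaTT.Ctx.susp_notMem hx)
  | unit_intro _ ih => exact .obj_intro ih
  | hom_intro _ _ _ _ ih₁ ih₂ => exact .hom_intro ih₁ ih₂
  | @var Γ x A hΓ hx ih =>
    simp only [MCaTT.Judgment.Susp, MCaTT.Tm.susp]
    split_ifs with hA
    · obtain rfl := (hΓ.mem_unitVars hx).1 hA
      exact .var ih (MCaTT.Ctx.susp_mem_zero _)
    · exact .var ih (hΓ.susp_mem hx fun e => hA ((hΓ.mem_unitVars hx).2 e))
  | tt_intro _ ih => exact .var ih (MCaTT.Ctx.susp_mem_zero _)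
  | @con_intro k Θ A Δ γ hA hγ ih =>
    simp only [MCaTT.Judgment.Susp, MCaTT.Tm.susp]
    have hr := hA.adm_der.1.red ih.presup.2
    rw [(hA.adm_der.2.desusp).suspSubst _ _ hγ, ← CaTT.Ty.subst_red _ hA.adm_der.2,
      CaTT.Ty.subst_subst _ (by rw [hr.scoped.2.2]; exact hA.scoped)]
    exact .con_intro hA (hr.subst _ _ ih)
  | conv _ h ih _ =>
    simp only [MCaTT.Judgment.Susp] at ih ⊢
    rwa [← MCaTT.Ty.susp_nf, ← h.eqNf, MCaTT.Ty.susp_nf]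
  | es _ ih =>
    exact .se (.es ih) (.obj_intro .ec) (by simp [CaTT.Ctx.vars])
      (.var ih (MCaTT.Ctx.susp_mem_zero _))
  | @se Δ Γ γ x A t hγ hA hx ht ih ihA iht =>
    simp only [MCaTT.Judgment.Susp, MCaTT.Sub.susp, MCaTT.Sub.susp_cons hγ.scoped.2.2 hx]
    cases A with
    | unit =>
      have hU : x ∈ (MCaTT.Ctx.cons Γ x .unit).unitVars := Finset.mem_insert_self _ _
      rwa [if_pos hU]
    | hom A u v =>
      have hU : x ∉ (MCaTT.Ctx.cons Γ x (.hom A u v)).unitVars :=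
        fun h => hx (MCaTT.Ctx.unitVars_subset _ h)
      rw [if_neg hU]
      refine .se ih ihA (MCaTT.Ctx.susp_notMem hx) ?_
      rw [← hA.suspSubst _ _ hγ]
      exact iht
  | _ => trivial

theorem MCaTT.Der.susp_idSub {Γ : MCaTT.Ctx} (h : MCaTT.Der (.ctx Γ)) :
    Γ.idSub.susp Γ.unitVars Γ.unitVars = Γ.susp.idSub := by
  induction Γ using MCaTT.Ctx.unitVars.induct with
  | case1 => rfl
  | case2 Γ x ih =>
    cases h with | ce hA hx =>
    have e := hA.presup.idSub.scoped
    simp only [MCaTT.Ctx.idSub, MCaTT.Sub.susp, MCaTT.Sub.susp_cons e.2.2 hx, MCaTT.Ctx.susp]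
    have hU : x ∈ (MCaTT.Ctx.cons Γ x .unit).unitVars := Finset.mem_insert_self _ _
    rw [if_pos hU, ← ih hA.presup]
    refine MCaTT.Sub.susp_congr_left _ _ fun y hy => MCaTT.unitVars_cons_subset _ _ _ ?_
    rintro rfl
    exact hx (e.2.1 hy)
  | case3 Γ x A t u ih =>
    cases h with | ce hA hx =>
    have hx' : x ∉ Γ.unitVars := fun h => hx (MCaTT.Ctx.unitVars_subset _ h)
    simp only [MCaTT.Ctx.idSub, MCaTT.Sub.susp, MCaTT.Ctx.unitVars, if_neg hx', MCaTT.Tm.susp,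
      MCaTT.Ctx.susp, CaTT.Ctx.idSub, ih hA.presup]

namespace SynMCaTT

open MCaTT

/-- The reduced suspension of an object. -/
def susp (a : SynMCaTT) : SynCaTT :=
  Quotient.lift (fun Γ : ValidCtx => (⟨Γ.ctx.susp, Γ.der.susp⟩ : SynCaTT))
    (fun Γ Γ' h => by
      have e : Γ.ctx.susp = Γ'.ctx.susp := by
        rw [← Ctx.susp_nf, (Der.eqNf (J := .ctxEq _ _) h).1, Ctx.susp_nf]
      simp only [e]) a

theorem IsSub.susp {a b : SynMCaTT} {γ : Sub} (h : a.IsSub γ b) :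
    CaTT.Der (.sub a.susp.ctx (γ.susp a.unitVars b.unitVars) b.susp.ctx) := by
  induction a using ind
  induction b using ind
  exact (isSub_mk.1 h).susp

/-- The reduced suspension of a morphism. -/
def Hom.susp {a b : SynMCaTT} (f : Hom a b) : a.susp ⟶ b.susp :=
  Quot.lift (fun γ : {γ : Sub // a.IsSub γ b} =>
      (⟨γ.1.susp a.unitVars b.unitVars, γ.2.susp⟩ : SynCaTT.Hom _ _))
    (fun γ γ' h => SynCaTT.Hom.ext (by
      have e := (subEq_iff γ.2 γ'.2).1 h
      change γ.1.susp _ _ = γ'.1.susp _ _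
      rw [← Sub.susp_nf, e, Sub.susp_nf])) f

end SynMCaTT

/-- The reduced suspension functor. -/
def reducedSuspension : SynMCaTT ⥤ SynCaTT where
  obj a := a.susp
  map f := SynMCaTT.Hom.susp f
  map_id a := by
    induction a using SynMCaTT.ind with | h Γ hΓ =>
    exact SynCaTT.Hom.ext hΓ.susp_idSub
  map_comp := by
    rintro a b c ⟨γ, hγ⟩ ⟨δ, hδ⟩
    induction a using SynMCaTT.ind
    induction b using SynMCaTT.ind
    induction c using SynMCaTT.ind
    rw [SynMCaTT.isSub_mk] at hγ hδ
    exact SynCaTT.Hom.ext (hδ.suspSubst _ _ hγ)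

/-- The components of the unit: `•` is mapped to `()`, and the renaming `x + 1` of a variable `x`
that is not of type `unit` is mapped to `x`. -/
def MCaTT.Ctx.etaSub : MCaTT.Ctx → MCaTT.Sub
  | .nil => .cons .nil 0 .tt
  | .cons Γ _ .unit => Γ.etaSub
  | .cons Γ x (.hom _ _ _) => .cons Γ.etaSub (x + 1) (.var x)

-- Definitional equality in MCaTT only identifies terms of type `1`, and it is decided on raw
-- syntax: replacing every variable of type `1` by `()` gives a normal form `nf`, and two valid
-- types, two terms of a common type, or two parallel substitutions are definitionally equal exactly
-- when their normal forms coincide. Every equation below is therefore an equality of raw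
-- expressions after `nf`.
--
-- Passing from `Γ` to `χΣΓ` deletes the variables of type `1` and adds the single variable `•`,
-- again of type `1`; every other variable `x` survives under the name `x + 1`, and `•` is `0`.
-- Nothing is lost up to definitional equality. The substitution `η_Γ` has the inverse `ε_Γ`
-- (`Ctx.epsSub`), which sends each variable of type `1` to `•` and any other `x` to `x + 1`. The
-- composite `ε_Γ ∘ η_Γ` is the normal form of the identity, and `η_Γ ∘ ε_Γ` differs from the
-- identity only in sending `•` to `()`.
--
-- The equations for types and terms and the naturality of `η` are proved together, by one induction
-- on derivations (`Der.etaNf`). The decisive case is a constructor, where `Σ` inserts `•_Θ`. By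
-- `Ctx.epsSub_desusp`, `χ(•_Θ)` is the inverse `ε_{χΘ}`. Hence the arguments of `(χΣ mop[γ])[η_Δ]`
-- are `ε_{χΘ} ∘ χΣγ ∘ η_Δ`; naturality at `γ` turns this into `ε_{χΘ} ∘ η_{χΘ} ∘ γ`, which is `γ`
-- up to normal form.
--
-- There is an apparent circle. Validity of `η` at `(Γ, x : A)` requires `x` to have type
-- `(χΣA)[η_Γ]`, hence the equation for `A`, while that equation is a judgment only once `η_Γ` is
-- valid. The equations between normal forms break it: they concern raw expressions and do not use
-- validity of `η`, so validity follows afterwards by induction on the context (`Der.etaSub`). The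
-- inverse is treated in the same way, with `Der.epsNf` and `Der.epsSub`.

namespace MCaTT

/-! ### Regularity of `MCaTT` -/

/-- The validity of the types, terms and substitutions presupposed by a judgment. -/
def Judgment.Regular : Judgment → Prop
  | .tm Γ _ A => Der (.ty Γ A)
  | .tyEq Γ A B => Der (.ty Γ A) ∧ Der (.ty Γ B)
  | .tmEq Γ t u A => Der (.ty Γ A) ∧ Der (.tm Γ t A) ∧ Der (.tm Γ u A)
  | .subEq Δ γ γ' Γ => Der (.sub Δ γ Γ) ∧ Der (.sub Δ γ' Γ)
  | _ => True

/-- Congruence of substitution in its second argument is not among the rules. It comes for free from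
normal forms, since the normal form of `A[γ]` depends on `γ` only through the normal form of `γ`. -/
theorem Der.tyEq_subst {Δ Γ : Ctx} {γ γ' : Sub} {A : Ty} (hA : Der (.ty Γ A))
    (hγ : Der (.sub Δ γ Γ)) (hγ' : Der (.sub Δ γ' Γ)) (h : Der (.subEq Δ γ γ' Γ)) :
    Der (.tyEq Δ (A.subst γ) (A.subst γ')) :=
  (hA.subst _ _ hγ).tyEq_of_nf (hA.subst _ _ hγ') (Ty.nf_subst h.eqNf A)

/-- The purpose is the case of terms: `Der.tmEq_eta` starts from `t : A` alone and needs `A` to be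
valid. Because of the conversion rule, this forces both sides of every equality of types, hence of
terms and substitutions, to be treated in the same induction. -/
theorem Der.regular {J : Judgment} (h : Der J) : J.Regular := by
  induction h with
  | var hΓ hx _ => exact hΓ.ty_of_mem hx
  | tt_intro h _ => exact .unit_intro h
  | con_intro hA hγ _ => exact (CaTT.Der.desusp hA hγ.presup.2).subst _ _ hγ
  | conv _ _ _ ih => exact ih.2
  | eta h₁ h₂ ih₁ _ => exact ⟨ih₁, h₁, h₂⟩
  | ty_refl h _ => exact ⟨h, h⟩
  | ty_symm _ ih => exact ih.symm
  | ty_trans _ _ ih₁ ih₂ => exact ⟨ih₁.1, ih₂.2⟩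
  | hom_congr h _ _ ih ih₁ ih₂ =>
    exact ⟨.hom_intro ih.1 ih₁.2.1 ih₂.2.1,
      -- The right-hand endpoints are only known to have type `A`, and must be moved to `A'`.
      .hom_intro ih.2 (.conv ih₁.2.2 h) (.conv ih₂.2.2 h)⟩
  | tm_refl h ih => exact ⟨ih, h, h⟩
  | tm_symm _ ih => exact ⟨ih.1, ih.2.symm⟩
  | tm_trans _ _ ih₁ ih₂ => exact ⟨ih₁.1, ih₁.2.1, ih₂.2.2⟩
  | tm_conv _ h ih ihA => exact ⟨ihA.2, .conv ih.2.1 h, .conv ih.2.2 h⟩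
  | con_congr hA h ih =>
    have iA := CaTT.Der.desusp hA ih.1.presup.2
    exact ⟨iA.subst _ _ ih.1, .con_intro hA ih.1,
      -- The introduction rule types the right-hand side by the instance of the type at `γ'`,
      -- whereas the judgment asks for the instance at `γ`.
      .conv (.con_intro hA ih.2) (.ty_symm (iA.tyEq_subst ih.1 ih.2 h))⟩
  | sub_refl h _ => exact ⟨h, h⟩
  | sub_symm _ ih => exact ih.symm
  | sub_trans _ _ ih₁ ih₂ => exact ⟨ih₁.1, ih₂.2⟩
  | se_congr h hA hx _ ih _ iht =>
    exact ⟨.se ih.1 hA hx iht.2.1,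
      -- Here the conversion goes the other way: `t'` is given at `A[γ]` and is needed at `A[γ']` to
      -- extend `γ'`.
      .se ih.2 hA hx (.conv iht.2.2 (hA.tyEq_subst ih.1 ih.2 h))⟩
  | _ => trivial

-- Further properties of normal forms

theorem Der.tmEq_of_nf {Γ : Ctx} {t u : Tm} {A : Ty} (ht : Der (.tm Γ t A))
    (hu : Der (.tm Γ u A)) (h : t.nf Γ.unitVars = u.nf Γ.unitVars) : Der (.tmEq Γ t u A) :=
  .tm_trans ht.nfEq (h ▸ .tm_symm hu.nfEq)

theorem Sub.dom_desusp (γ : CaTT.Sub) : γ.desusp.dom = γ.dom := by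
  induction γ using CaTT.Sub.dom.induct with
  | case1 => rfl
  | case2 γ x t ih => simp only [CaTT.Sub.desusp, Sub.dom, CaTT.Sub.dom, ih]

-- Normalisation only consults the set of unit variables at the variables that occur. This is what
-- allows a fresh variable of type `1` to be added to the context without changing the normal form
-- of an older substitution.
mutual
theorem Tm.nf_congr {U V : Finset ℕ} :
    (t : Tm) → (∀ x ∈ t.vars, x ∈ U ↔ x ∈ V) → t.nf U = t.nf V
  | .var x, h => by simp only [Tm.nf, h x (by simp [Tm.vars])]
  | .tt, _ => rfl
  | .con k Θ A γ, h => by simp only [Tm.nf, Sub.nf_congr γ h]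
theorem Sub.nf_congr {U V : Finset ℕ} :
    (γ : Sub) → (∀ x ∈ γ.vars, x ∈ U ↔ x ∈ V) → γ.nf U = γ.nf V
  | .nil, _ => rfl
  | .cons γ x t, h => by
    simp only [Sub.vars, Finset.mem_union] at h
    simp only [Sub.nf, Sub.nf_congr γ fun x hx => h x (Or.inl hx),
      Tm.nf_congr t fun x hx => h x (Or.inr hx)]
end

/-! ### The unit on raw expressions -/

theorem Ctx.vars_etaSub (Γ : Ctx) : Γ.etaSub.vars ⊆ Γ.vars := by
  induction Γ using Ctx.unitVars.induct with
  | case1 => simp [Ctx.etaSub, Sub.vars, Tm.vars]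
  | case2 Γ x ih => exact ih.trans (Finset.subset_insert _ _)
  | case3 Γ x A t u ih =>
    simp only [Ctx.etaSub, Sub.vars, Tm.vars, Ctx.vars]
    exact Finset.union_subset (ih.trans (Finset.subset_insert _ _)) (by simp)

/-- Composition of raw substitutions is associative only when the middle one assigns all the
variables in use; this lemma and `Ctx.vars_epsSub` supply that condition for `ε ∘ η`. -/
theorem Ctx.dom_etaSub (Γ : Ctx) : Γ.etaSub.dom = Γ.susp.vars := by
  induction Γ using Ctx.unitVars.induct with
  | case1 => rfl
  | case2 Γ x ih => exact ih
  | case3 Γ x A t u ih => simp only [Ctx.etaSub, Sub.dom, Ctx.susp, CaTT.Ctx.vars, ih]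

theorem Ctx.etaSub_get_zero (Γ : Ctx) : Γ.etaSub.get 0 = .tt := by
  induction Γ using Ctx.unitVars.induct with
  | case1 => rfl
  | case2 Γ x ih => exact ih
  | case3 Γ x A t u ih => simpa [Ctx.etaSub, Sub.get] using ih

theorem Der.etaSub_get_succ {Γ : Ctx} (hΓ : Der (.ctx Γ)) {x : ℕ} (hx : x ∈ Γ.vars)
    (hU : x ∉ Γ.unitVars) : Γ.etaSub.get (x + 1) = .var x := by
  induction Γ using Ctx.unitVars.induct with
  | case1 => simp [Ctx.vars] at hx
  | case2 Γ y ih =>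
    cases hΓ with | ce hA _ =>
    simp only [Ctx.unitVars, Finset.mem_insert, not_or] at hU
    exact ih hA.presup ((Finset.mem_insert.1 hx).resolve_left hU.1) hU.2
  | case3 Γ y A t u ih =>
    cases hΓ with | ce hA _ =>
    simp only [Ctx.etaSub, Sub.get, Nat.add_right_cancel_iff]
    split_ifs with h
    · rw [h]
    · exact ih hA.presup ((Finset.mem_insert.1 hx).resolve_left h) hU

/-- The substitution `η_Γ` depends only on the names in `Γ` and on which types are `1`, and `nf`
preserves both. Hence `η` descends to contexts up to definitional equality. -/
theorem Ctx.etaSub_nf (Γ : Ctx) : Γ.nf.etaSub = Γ.etaSub := by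
  induction Γ using Ctx.unitVars.induct with
  | case1 => rfl
  | case2 Γ x ih => simp only [Ctx.nf, Ty.nf, Ctx.etaSub, ih]
  | case3 Γ x A t u ih => simp only [Ctx.nf, Ty.nf, Ctx.etaSub, ih]

-- The inverse of the unit on raw expressions

/-- The components of the inverse of the unit: a variable of type `unit` is mapped to `•`, and any
other variable `x` to its renaming `x + 1`. -/
def Ctx.epsSub : Ctx → Sub
  | .nil => .nil
  | .cons Γ x .unit => .cons Γ.epsSub x (.var 0)
  | .cons Γ x (.hom _ _ _) => .cons Γ.epsSub x (.var (x + 1))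

/-- This is the bridge between `Σ` and the inverse of `η`: the correction `•_Θ` that `Σ` inserts
under a constructor becomes, after desuspension, the component of that inverse at `χΘ`. -/
theorem Ctx.epsSub_desusp (Θ : CaTT.Ctx) : Θ.desusp.epsSub = Θ.red.desusp := by
  induction Θ using CaTT.Ctx.red.induct with
  | case1 => rfl
  | case2 Θ x ih =>
    simp only [CaTT.Ctx.desusp, CaTT.Ty.desusp, Ctx.epsSub, CaTT.Ctx.red, CaTT.Sub.desusp, ih,
      CaTT.Tm.desusp]
  | case3 Θ x A t u ih =>
    simp only [CaTT.Ctx.desusp, CaTT.Ty.desusp, Ctx.epsSub, CaTT.Ctx.red, CaTT.Sub.desusp, ih,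
      CaTT.Tm.desusp]

theorem Ctx.epsSub_nf (Γ : Ctx) : Γ.nf.epsSub = Γ.epsSub := by
  induction Γ using Ctx.unitVars.induct with
  | case1 => rfl
  | case2 Γ x ih => simp only [Ctx.nf, Ty.nf, Ctx.epsSub, ih]
  | case3 Γ x A t u ih => simp only [Ctx.nf, Ty.nf, Ctx.epsSub, ih]

theorem Ctx.vars_epsSub (Γ : Ctx) : Γ.epsSub.vars ⊆ Γ.susp.vars := by
  induction Γ using Ctx.unitVars.induct with
  | case1 => simp [Ctx.epsSub, Sub.vars]
  | case2 Γ x ih =>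
    simp only [Ctx.epsSub, Sub.vars, Tm.vars, Ctx.susp]
    exact Finset.union_subset ih (by simpa using (Ctx.susp_mem_zero Γ).mem_vars)
  | case3 Γ x A t u ih =>
    simp only [Ctx.epsSub, Sub.vars, Tm.vars, Ctx.susp, CaTT.Ctx.vars]
    exact Finset.union_subset (ih.trans (Finset.subset_insert _ _)) (by simp)

theorem Ctx.succ_notMem_vars_epsSub {Γ : Ctx} {x : ℕ} (hx : x ∉ Γ.vars) :
    x + 1 ∉ Γ.epsSub.vars := fun h => Ctx.susp_notMem hx (Γ.vars_epsSub h)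

/-- The conditional is the one that defines `Σ` on variables, so that `x[ε_Γ]` and `χΣx` agree
branch by branch. Validity of `Γ` excludes a name declared both with type `1` and with an arrow
type. -/
theorem Der.epsSub_get {Γ : Ctx} (hΓ : Der (.ctx Γ)) {x : ℕ} (hx : x ∈ Γ.vars) :
    Γ.epsSub.get x = .var (if x ∈ Γ.unitVars then 0 else x + 1) := by
  induction Γ using Ctx.unitVars.induct with
  | case1 => simp [Ctx.vars] at hx
  | case2 Γ y ih =>
    cases hΓ with | ce hA _ =>
    by_cases h : x = y
    · simp [Ctx.epsSub, Sub.get, h, Ctx.unitVars]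
    · have e := ih hA.presup ((Finset.mem_insert.1 hx).resolve_left h)
      by_cases hU : x ∈ Γ.unitVars <;>
        simpa [Ctx.epsSub, Sub.get, h, Ctx.unitVars, hU] using e
  | case3 Γ y A t u ih =>
    cases hΓ with | ce hA hy =>
    by_cases h : x = y
    · have hU : y ∉ Γ.unitVars := fun h => hy (Ctx.unitVars_subset _ h)
      simp [Ctx.epsSub, Sub.get, h, Ctx.unitVars, hU]
    · have e := ih hA.presup ((Finset.mem_insert.1 hx).resolve_left h)
      by_cases hU : x ∈ Γ.unitVars <;>
        simpa [Ctx.epsSub, Sub.get, h, Ctx.unitVars, hU] using e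

-- The two composites

/-- A variable of type `1` travels `x ↦ • ↦ ()`, any other `x ↦ x + 1 ↦ x`. The composite is thus
literally the normal form of the identity, and can be rewritten inside a larger composite. -/
theorem Der.epsSub_comp_etaSub {Γ : Ctx} (hΓ : Der (.ctx Γ)) :
    Γ.epsSub.comp Γ.etaSub = Γ.idSub.nf Γ.unitVars := by
  induction Γ using Ctx.unitVars.induct with
  | case1 => rfl
  | case2 Γ x ih =>
    cases hΓ with | ce hA hx =>
    -- The goal normalises with `x` counted as a unit variable and the induction hypothesis without
    -- it; `x` is fresh, so it does not occur in the identity of `Γ`.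
    have e : Γ.idSub.nf (insert x Γ.unitVars) = Γ.idSub.nf Γ.unitVars :=
      Sub.nf_congr _ fun y hy => by
        rw [Ctx.vars_idSub] at hy
        rw [Finset.mem_insert, or_iff_right (by rintro rfl; exact hx hy)]
    simp only [Ctx.epsSub, Ctx.etaSub, Sub.comp, Tm.subst, Ctx.etaSub_get_zero, Ctx.idSub,
      Ctx.unitVars, Sub.nf, Tm.nf, Finset.mem_insert_self, if_true, e, ih hA.presup]
  | case3 Γ x A t u ih =>
    cases hΓ with | ce hA hx =>
    have hU : x ∉ Γ.unitVars := fun h => hx (Ctx.unitVars_subset _ h)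
    simp only [Ctx.epsSub, Ctx.etaSub, Sub.comp, Tm.subst, Sub.get, if_true, Ctx.idSub,
      Ctx.unitVars, Sub.nf, Tm.nf, hU, if_false, ih hA.presup,
      Sub.comp_cons _ (Ctx.succ_notMem_vars_epsSub hx)]

/-- Each `x + 1` returns to itself, but `•` goes to `()`, so the equality holds only after a
normalisation that erases `•`. Nothing else about `W` matters, and leaving it arbitrary keeps it
fixed during the induction. -/
theorem Der.etaSub_comp_epsSub {Γ : Ctx} (hΓ : Der (.ctx Γ)) {W : Finset ℕ} (hW : 0 ∈ W) :
    (Γ.etaSub.comp Γ.epsSub).nf W = Γ.susp.desusp.idSub.nf W := by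
  induction Γ using Ctx.unitVars.induct with
  | case1 =>
    simp [Ctx.etaSub, Ctx.susp, Sub.comp, Tm.subst, CaTT.Ctx.desusp, Ctx.idSub, Sub.nf, Tm.nf, hW]
  | case2 Γ x ih =>
    cases hΓ with | ce hA hx =>
    simp only [Ctx.etaSub, Ctx.epsSub, Ctx.susp,
      Sub.comp_cons _ fun h => hx (Γ.vars_etaSub h), ih hA.presup]
  | case3 Γ x A t u ih =>
    cases hΓ with | ce hA hx =>
    simp only [Ctx.etaSub, Ctx.epsSub, Ctx.susp, CaTT.Ctx.desusp, Ctx.idSub, Sub.comp, Sub.nf,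
      Tm.subst, Sub.get, if_true, Sub.comp_cons _ fun h => hx (Γ.vars_etaSub h), ih hA.presup]

-- Naturality and the comparison equations on normal forms

/-- The naturality of the unit, up to normal forms. -/
def Judgment.EtaNf : Judgment → Prop
  | .ty Γ A => ((A.susp Γ.unitVars).desusp.subst Γ.etaSub).nf Γ.unitVars = A.nf Γ.unitVars
  | .tm Γ t _ => ((t.susp Γ.unitVars).desusp.subst Γ.etaSub).nf Γ.unitVars = t.nf Γ.unitVars
  | .sub Δ γ Γ =>
      (Γ.etaSub.comp γ).nf Δ.unitVars =
        ((γ.susp Δ.unitVars Γ.unitVars).desusp.comp Δ.etaSub).nf Δ.unitVars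
  | _ => True

/-- Types, terms and substitutions depend on one another through constructors and extensions, so the
comparison equations and naturality form one induction. Only the expression being compared has to be
derivable; validity of `η` is not used. -/
theorem Der.etaNf {J : Judgment} (h : Der J) : J.EtaNf := by
  induction h with
  | unit_intro _ _ => exact rfl
  | hom_intro _ _ _ ih ih₁ ih₂ =>
    simp only [Judgment.EtaNf] at ih ih₁ ih₂
    simp only [Judgment.EtaNf, Ty.susp, CaTT.Ty.desusp, Ty.subst, Ty.nf, ih, ih₁, ih₂]
  | @var Γ x A hΓ hx _ =>
    simp only [Judgment.EtaNf, Tm.susp]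
    split_ifs with hU
    · simp [CaTT.Tm.desusp, Tm.subst, Ctx.etaSub_get_zero, Tm.nf, hU]
    · simp only [CaTT.Tm.desusp, Tm.subst, hΓ.etaSub_get_succ hx.mem_vars hU]
  | tt_intro _ _ => simp only [Judgment.EtaNf, Tm.susp, CaTT.Tm.desusp, Tm.subst,
      Ctx.etaSub_get_zero]
  | @con_intro k Θ A Δ γ hA hγ ih =>
    simp only [Judgment.EtaNf] at ih
    have hΘ := hγ.presup.2
    have d : Θ.red.desusp.vars ⊆ ((γ.susp Δ.unitVars Θ.desusp.unitVars).desusp).dom := by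
      rw [vars_desusp_sub, Sub.dom_desusp]
      exact red_vars_subset hA.adm_der.1 (by rw [hγ.scoped.2.2, vars_desusp])
    have d' : Θ.desusp.epsSub.vars ⊆ Θ.desusp.etaSub.dom := by
      rw [Ctx.dom_etaSub]
      exact Ctx.vars_epsSub _
    -- Precomposing the normal form of the identity with `γ` gives `γ` up to `nf`: the entries
    -- replaced by `()` are those where `γ` takes a term of type `1`. This is read off from the
    -- equality of the identity with its normal form, substituted along `γ`.
    have e := (hΘ.idSub.nfEq.subst _ _ hγ).eqNf
    simp only [Judgment.EqNf, hγ.idSub_comp] at e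
    simp only [Judgment.EtaNf, Tm.susp, CaTT.Tm.desusp, Tm.subst, Tm.nf, CaTT.Sub.desusp_comp]
    -- Up to normal form, `(χ(•_Θ) ∘ χΣγ) ∘ η_Δ` becomes `χ(•_Θ) ∘ (η_{χΘ} ∘ γ)` by naturality at
    -- `γ`, then `(ε_{χΘ} ∘ η_{χΘ}) ∘ γ`, then `γ`.
    rw [Sub.comp_comp _ d, ← Sub.nf_comp ih, ← Ctx.epsSub_desusp, ← Sub.comp_comp _ d',
      hΘ.epsSub_comp_etaSub, ← e]
  | conv _ _ ih _ => exact ih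
  | es _ _ =>
    simp only [Judgment.EtaNf, Ctx.etaSub, Sub.susp, Sub.comp, CaTT.Sub.desusp, CaTT.Tm.desusp,
      Tm.subst, Ctx.etaSub_get_zero]
  | @se Δ Γ γ x A t hγ hA hx ht ih _ iht =>
    simp only [Judgment.EtaNf] at ih iht
    have hη : x ∉ Γ.etaSub.vars := fun h => hx (Γ.vars_etaSub h)
    simp only [Judgment.EtaNf, Sub.susp, Sub.susp_cons hγ.scoped.2.2 hx]
    cases A with
    | unit =>
      have hU : x ∈ (Ctx.cons Γ x .unit).unitVars := Finset.mem_insert_self _ _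
      -- Both `Σ` and `η` skip an entry of type `1`, and the leftover `x ↦ t` acts trivially because
      -- `x` does not occur in `η_Γ`.
      rw [if_pos hU, Ctx.etaSub, Sub.comp_cons _ hη, ih]
    | hom A u v =>
      have hU : x ∉ (Ctx.cons Γ x (.hom A u v)).unitVars := fun h => hx (Ctx.unitVars_subset _ h)
      rw [if_neg hU]
      simp only [Ctx.etaSub, Sub.comp, Sub.comp_cons _ hη, Tm.subst, Sub.get, if_true, Sub.nf,
        CaTT.Sub.desusp, ih, iht]
  | _ => trivial

/-- The naturality of the inverse of the unit, up to normal forms. -/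
def Judgment.EpsNf (W : Finset ℕ) : Judgment → Prop
  | .ty Γ A => (A.subst Γ.epsSub).nf W = (A.susp Γ.unitVars).desusp.nf W
  | .tm Γ t _ => (t.subst Γ.epsSub).nf W = (t.susp Γ.unitVars).desusp.nf W
  | .sub Δ γ Γ =>
      (γ.comp Δ.epsSub).nf W =
        (Γ.epsSub.comp (γ.susp Δ.unitVars Γ.unitVars).desusp).nf W
  | _ => True

/-- Since `ε` replaces variables exactly as `Σ` does, acting by `ε_Γ` is the same as applying `χΣ`,
apart from `()`, which `Σ` sends to `•`; this is where `0 ∈ W` is needed. For a constructor, `χ(•_Θ)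
∘ χΣγ` is already `ε_{χΘ} ∘ χΣγ`, so the induction hypothesis applies at once. The case of types is
what the validity of `ε` requires. -/
theorem Der.epsNf {W : Finset ℕ} (hW : 0 ∈ W) {J : Judgment} (h : Der J) : J.EpsNf W := by
  induction h with
  | unit_intro _ _ => exact rfl
  | hom_intro _ _ _ ih ih₁ ih₂ =>
    simp only [Judgment.EpsNf] at ih ih₁ ih₂
    simp only [Judgment.EpsNf, Ty.susp, CaTT.Ty.desusp, Ty.subst, Ty.nf, ih, ih₁, ih₂]
  | @var Γ x A hΓ hx _ =>
    simp only [Judgment.EpsNf, Tm.susp, Tm.subst, hΓ.epsSub_get hx.mem_vars]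
    split_ifs <;> rfl
  | tt_intro _ _ => simp [Judgment.EpsNf, Tm.susp, CaTT.Tm.desusp, Tm.subst, Tm.nf, hW]
  | con_intro _ _ ih =>
    simp only [Judgment.EpsNf] at ih
    simp only [Judgment.EpsNf, Tm.susp, CaTT.Tm.desusp, Tm.subst, Tm.nf, CaTT.Sub.desusp_comp, ih,
      Ctx.epsSub_desusp]
  | conv _ _ ih _ => exact ih
  | es _ _ => exact rfl
  | @se Δ Γ γ x A t hγ hA hx ht ih _ iht =>
    simp only [Judgment.EpsNf] at ih iht
    simp only [Judgment.EpsNf, Sub.susp, Sub.susp_cons hγ.scoped.2.2 hx]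
    cases A with
    | unit =>
      have hU : x ∈ (Ctx.cons Γ x .unit).unitVars := Finset.mem_insert_self _ _
      have h0 : ((γ.susp Δ.unitVars Γ.unitVars).desusp.get 0) = .var 0 := by
        have := CaTT.Tm.desusp_subst (γ.susp Δ.unitVars Γ.unitVars) (.var 0)
        simpa only [CaTT.Tm.subst, Sub.susp_get_zero, CaTT.Tm.desusp, Tm.subst] using this.symm
      -- A term of type `1` is a variable of type `1` or `()`, never a constructor, so its
      -- suspension is `•`.
      have ht' : t.susp Δ.unitVars = .var 0 := (ht.unitInv.1 rfl).susp
      rw [ht'] at iht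
      rw [if_pos hU]
      simp only [Ctx.epsSub, Sub.comp, Sub.nf, Tm.subst, h0, ih, iht, CaTT.Tm.desusp]
    | hom A u v =>
      have hU : x ∉ (Ctx.cons Γ x (.hom A u v)).unitVars := fun h => hx (Ctx.unitVars_subset _ h)
      rw [if_neg hU]
      simp only [Ctx.epsSub, Sub.comp, CaTT.Sub.desusp,
        Sub.comp_cons _ (Ctx.succ_notMem_vars_epsSub hx), Tm.subst, Sub.get, if_true, Sub.nf,
        ih, iht]
  | _ => trivial

/-! ### Validity of the unit and of its inverse -/

/-- Validity of `η_Γ` is kept as a hypothesis because `Der.etaSub` calls this lemma inside its own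
induction, at the shorter context. -/
theorem Der.tyEq_eta {Γ : Ctx} {A : Ty} (hA : Der (.ty Γ A))
    (hη : Der (.sub Γ Γ.etaSub Γ.susp.desusp)) :
    Der (.tyEq Γ A ((A.susp Γ.unitVars).desusp.subst Γ.etaSub)) :=
  hA.tyEq_of_nf (hA.susp.desusp.subst _ _ hη) hA.etaNf.symm

theorem Der.etaSub {Γ : Ctx} (hΓ : Der (.ctx Γ)) : Der (.sub Γ Γ.etaSub Γ.susp.desusp) := by
  induction Γ using Ctx.unitVars.induct with
  | case1 =>
    exact .se (.es hΓ) (.unit_intro .ec) (by simp [CaTT.Ctx.desusp, Ctx.vars]) (.tt_intro hΓ)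
  | case2 Γ x ih =>
    have k := hΓ
    cases hΓ with | ce hA hx =>
    exact (ih hA.presup).weaken _ (fun _ _ => Or.inr) k
  | case3 Γ x A t u ih =>
    have k := hΓ
    cases hΓ with | ce hA hx =>
    have hη := ih hA.presup
    exact .se (hη.weaken _ (fun _ _ => Or.inr) k) hA.susp.desusp
      (by rw [vars_desusp]; exact Ctx.susp_notMem hx)
      -- The variable `x` is declared with type `A`, and the entry at `x + 1` must have type
      -- `(χΣA)[η_Γ]`.
      (.conv (.var k (Or.inl ⟨rfl, rfl⟩)) ((hA.tyEq_eta hη).weaken _ (fun _ _ => Or.inr) k))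

/-- Substitution types the right-hand side by `(χΣA)[η_Γ]`; it is brought back to `A` by the
equation for types before normal forms are compared. -/
theorem Der.tmEq_eta {Γ : Ctx} {t : Tm} {A : Ty} (ht : Der (.tm Γ t A)) :
    Der (.tmEq Γ t ((t.susp Γ.unitVars).desusp.subst Γ.etaSub) A) := by
  have hA : Der (.ty Γ A) := ht.regular
  have hη := hA.presup.etaSub
  exact ht.tmEq_of_nf (.conv (ht.susp.desusp.2.subst _ _ hη) (.ty_symm (hA.tyEq_eta hη)))
    ht.etaNf.symm

theorem Der.zero_mem_unitVars_susp {Γ : Ctx} (hΓ : Der (.ctx Γ)) :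
    0 ∈ Γ.susp.desusp.unitVars :=
  (hΓ.susp.desusp.mem_unitVars (Ctx.susp_mem_zero Γ).desusp).2 rfl

theorem Der.epsSub {Γ : Ctx} (hΓ : Der (.ctx Γ)) : Der (.sub Γ.susp.desusp Γ.epsSub Γ) := by
  induction Γ using Ctx.unitVars.induct with
  | case1 => exact .es hΓ.susp.desusp
  | case2 Γ x ih =>
    have k : Der (.ctx Γ.susp.desusp) := hΓ.susp.desusp
    cases hΓ with | ce hA hx =>
    exact .se (ih hA.presup) hA hx (.var k (Ctx.susp_mem_zero Γ).desusp)
  | case3 Γ x A t u ih =>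
    have k : Der (.ctx (Ctx.cons Γ x (.hom A t u)).susp.desusp) := hΓ.susp.desusp
    cases hΓ with | ce hA hx =>
    have hε := ih hA.presup
    -- The equality is `χΣA ≡ A[ε_Γ]`: the variable `x + 1` is declared with the first type and must
    -- have the second.
    have e : Der (.tyEq Γ.susp.desusp _ _) := hA.susp.desusp.tyEq_of_nf (hA.subst _ _ hε)
      (hA.epsNf hA.presup.zero_mem_unitVars_susp).symm
    exact .se (hε.weaken _ (fun _ _ => Or.inr) k) hA hx
      (.conv (.var k (Or.inl ⟨rfl, rfl⟩)) (e.weaken _ (fun _ _ => Or.inr) k))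

end MCaTT

-- The natural isomorphism between functors

namespace SynMCaTT

open MCaTT

/-- Passage from the quotient to raw syntax: the isomorphism laws and naturality all reduce to
equalities of normal forms. -/
theorem hom_mk_eq {a b : SynMCaTT} {γ γ' : Sub} {h : a.IsSub γ b} {h' : a.IsSub γ' b}
    (e : γ.nf a.unitVars = γ'.nf a.unitVars) : Hom.mk γ h = Hom.mk γ' h' :=
  Quot.sound ((subEq_iff h h').2 e)

/-- The raw substitution underlying the unit at an object. -/
def etaSub (a : SynMCaTT) : Sub :=
  Quotient.lift (fun Γ : ValidCtx => Γ.ctx.etaSub)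
    (fun Γ Γ' h => by
      rw [← Ctx.etaSub_nf, (Der.eqNf (J := .ctxEq _ _) h).1, Ctx.etaSub_nf]) a

/-- The raw substitution underlying the inverse of the unit at an object. -/
def epsSub (a : SynMCaTT) : Sub :=
  Quotient.lift (fun Γ : ValidCtx => Γ.ctx.epsSub)
    (fun Γ Γ' h => by
      rw [← Ctx.epsSub_nf, (Der.eqNf (J := .ctxEq _ _) h).1, Ctx.epsSub_nf]) a

theorem isSub_etaSub (a : SynMCaTT) :
    a.IsSub a.etaSub ((reducedSuspension ⋙ desuspension).obj a) := by
  induction a using ind with | h Γ hΓ =>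
  exact isSub_mk.2 hΓ.etaSub

theorem isSub_epsSub (a : SynMCaTT) :
    ((reducedSuspension ⋙ desuspension).obj a).IsSub a.epsSub a := by
  induction a using ind with | h Γ hΓ =>
  exact isSub_mk.2 hΓ.epsSub

/-- The component of the unit at an object. -/
def etaIso (a : SynMCaTT) : a ≅ (reducedSuspension ⋙ desuspension).obj a where
  hom := Hom.mk a.etaSub a.isSub_etaSub
  inv := Hom.mk a.epsSub a.isSub_epsSub
  hom_inv_id := by
    induction a using ind with | h Γ hΓ =>
    refine hom_mk_eq ?_
    change (Γ.epsSub.comp Γ.etaSub).nf Γ.unitVars = Γ.idSub.nf Γ.unitVars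
    rw [hΓ.epsSub_comp_etaSub]
    -- What remains is the idempotence of `nf` on the identity, which holds because the identity is
    -- definitionally equal to its normal form.
    exact hΓ.idSub.nfEq.eqNf.symm
  inv_hom_id := by
    induction a using ind with | h Γ hΓ =>
    exact hom_mk_eq (hΓ.etaSub_comp_epsSub hΓ.zero_mem_unitVars_susp)

/-- The natural isomorphism from the identity to the desuspension of the reduced suspension. -/
def etaNatIso : 𝟭 SynMCaTT ≅ reducedSuspension ⋙ desuspension :=
  NatIso.ofComponents etaIso (by
    rintro a b ⟨γ, hγ⟩
    induction a using ind
    induction b using ind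
    -- The naturality square is the clause for substitutions of the induction.
    exact hom_mk_eq (isSub_mk.1 hγ).etaNf)

end SynMCaTT

theorem mainTheorem3 :
    ∃ η : 𝟭 SynMCaTT ≅ reducedSuspension ⋙ desuspension,
      ∀ (Γ : MCaTT.Ctx) (hΓ : MCaTT.Der (.ctx Γ)),
        (∃ h, η.hom.app (SynMCaTT.mk Γ hΓ) = SynMCaTT.Hom.mk Γ.etaSub h) ∧
        (∀ A : MCaTT.Ty, MCaTT.Der (.ty Γ A) →
          MCaTT.Der (.tyEq Γ A ((A.susp Γ.unitVars).desusp.subst Γ.etaSub))) ∧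
        (∀ (t : MCaTT.Tm) (A : MCaTT.Ty), MCaTT.Der (.tm Γ t A) →
          MCaTT.Der (.tmEq Γ t ((t.susp Γ.unitVars).desusp.subst Γ.etaSub) A)) :=
  ⟨SynMCaTT.etaNatIso, fun _ hΓ =>
    -- The component agrees by computation, since the lift to the quotient evaluates to `Γ.etaSub`
    -- on the class of `Γ`.
    ⟨⟨SynMCaTT.isSub_etaSub _, rfl⟩, fun _ hA => hA.tyEq_eta hΓ.etaSub, fun _ _ ht => ht.tmEq_eta⟩⟩
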